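/- Let $c_1,c_2>0$. There is a constant $C>0$ depending only on $c_1,c_2$ such that the following holds. Let $p$ be a prime and let $\Gamma\subseteq\mathbb F_p^*=\mathbb F_p\setminus\{0\}$ be a multiplicative subgroup with $|\Gamma|\ge 2$ and $c_1p^{1/2}\le|\Gamma|\le c_2p^{3/4}$. Put $$M(\Gamma)=\max_{\xi\in\mathbb F_p,\ \xi\ne0}\Big|\sum_{x\in\Gamma}e^{2\pi i x\xi/p}\Big|,$$ and for $A,B\subseteq\mathbb F_p$ put $(A\circ A)(x)=|\{y\in A: y+x\in A\}|$, $$\mathsf E_3(A)=\sum_{x\in\mathbb F_p}(A\circ A)(x)^3,\qquad \mathsf E_3(A,B)=\sum_{x\in\mathbb F_p}(A\circ A)(x)\,(B\circ B)(x)^2 .$$ Then, with $\log=\log_2$, $$\Big|\mathsf E_3(\Gamma)-\frac{|\Gamma|^6}{p^2}\Big|\le C\Big(|\Gamma|^3\log^3|\Gamma|+p^{1/3}M(\Gamma)^{4/3}|\Gamma|^{5/3}\log^3|\Gamma|\Big).$$ Moreover, for every $\Gamma$-invariant set $S$, that is, every $S\subseteq\mathbb F_p^*$ with $S\Gamma=S$,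 $$\Big|\mathsf E_3(\Gamma,S)-\frac{|\Gamma|^2|S|^4}{p^2}\Big|\le C\Big(|S|^2|\Gamma|\log^3|\Gamma|+\frac{|S|^3M(\Gamma)^2}{p}+p^{2/3}M(\Gamma)^{2/3}|S|^2|\Gamma|^{-1/3}\log^3|\Gamma|\Big)$$ and $$\Big|\mathsf E_3(S)-\frac{|S|^6}{p^2}\Big|\le C\Big(|S|^4|\Gamma|^{-1}+p\,|S|^3|\Gamma|^{-4/3}\log^3|\Gamma|\Big).$$ -/

import Mathlib

open scoped Pointwise

noncomputable section

namespace SubgroupEnergy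

/-- The characteristic function `G → {0, 1} ⊆ ℝ` of a set. -/
def char {G : Type*} (A : Set G) : G → ℝ := A.indicator 1

/-- The correlation `(f ∘ g)(x) = ∑ y, f(y) g(y + x)`. -/
def corr {G : Type*} [AddCommGroup G] [Fintype G] (f g : G → ℝ) (x : G) : ℝ :=
  ∑ y, f y * g (y + x)

/-- The higher energy `E_k(A) = ∑ x, (A ∘ A)(x) ^ k` of one set. -/
def energy {G : Type*} [AddCommGroup G] [Fintype G] (k : ℕ) (A : Set G) : ℝ :=
  ∑ x, corr (char A) (char A) x ^ k

/-- The higher energy `E_k(A, B) = ∑ x, (A ∘ A)(x) (B ∘ B)(x) ^ (k - 1)` of two sets, `k ≥ 1`. -/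
def energyPair {G : Type*} [AddCommGroup G] [Fintype G] (k : ℕ) (A B : Set G) : ℝ :=
  ∑ x, corr (char A) (char A) x * corr (char B) (char B) x ^ (k - 1)

/-- A subgroup of the multiplicative group of `𝔽_p`, regarded as a subset of `𝔽_p`. -/
def toSet {p : ℕ} (Γ : Subgroup (ZMod p)ˣ) : Set (ZMod p) :=
  (fun u : (ZMod p)ˣ => (u : ZMod p)) '' (Γ : Set (ZMod p)ˣ)

open Classical in
/-- The maximal nonzero Fourier coefficient
`M(Γ) = max_{ξ ≠ 0} |∑_{x ∈ Γ} exp (2 π i x ξ / p)|`.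
`ZMod.stdAddChar` is the character `j ↦ exp (2 π i j / p)` of `ZMod p`; for `p` prime the supremum
is over a finite nonempty set, so it is a maximum. -/
def maxFourier {p : ℕ} [NeZero p] (Γ : Subgroup (ZMod p)ˣ) : ℝ :=
  ⨆ ξ : {ξ : ZMod p // ξ ≠ 0},
    ‖∑ x : ZMod p with x ∈ toSet Γ, (ZMod.stdAddChar (x * ξ.1) : ℂ)‖

/-- A set `Q ⊆ 𝔽_p \ {0}` is `Γ`-invariant if `QΓ = Q`. -/
def IsInvariant {p : ℕ} (Γ : Subgroup (ZMod p)ˣ) (Q : Set (ZMod p)) : Prop :=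
  (0 : ZMod p) ∉ Q ∧ Q * toSet Γ = Q

end SubgroupEnergy

end

/-! Write the number of representations of `x` as a difference in `A` as its average `|A|²/p` plus a
deviation `dev A x`. Since the deviation sums to zero, expanding the third energy leaves the main
term, second moments of deviations weighted by averages, and one cubic moment
(`sum_diffCount_mul_sq_sub`). The second moments are handled by Parseval: for a `Γ`-invariant set
the Fourier transform is constant on orbits of `Γ`, so no nonzero frequency can carry more than a
`1/|Γ|` share of the total mass.

The cubic moment rests on Stepanov's method (`stepanov_card_cube_le`), which bounds the number of
`y` with `(y^t, (1-y)^t)` in a prescribed set of `k` pairs by a constant times `(kt)^(2/3)`, where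
`t = |Γ|`. It is used in two ways. First, a difference `ξ = x' - x` in `Γ` gives the point `y =
-x/ξ`, whose pair depends only on the coset of `ξ`; this yields a weak-type bound for popular
differences (`sq_mul_sum_popular_le`). Splitting at a popularity threshold, with `L²` bounds below
it, and summing dyadically or using a sup bound above it, gives the estimates for `E₃(Γ)` and `E₃(Γ,
S)`. Second, for `E₃(S)`, averaging the Fourier expansion of `dev S` over `Γ` and cubing produces
counts of `αξ + βη + γζ = 0` in `Γ`; Stepanov with a single pair bounds each by `O(t^(5/3))`
(`relationCount_cube_le`).

Stepanov requires `16kt⁴ ≤ p³`. When even `k = 1` violates this, the Gauss-sum bound `M(Γ) ≤ √p`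
already suffices. -/

namespace SubgroupEnergy

/-! ### Stepanov's polynomial method. -/

section Stepanov

open Polynomial

variable {F : Type*} [Field F]

/-- The derivation `x (1 - x) d/dx` on polynomials. -/
noncomputable def eulerOp : F[X] →ₗ[F] F[X] :=
  LinearMap.mulLeft F (X * (1 - X)) ∘ₗ derivative

theorem eulerOp_apply (q : F[X]) : eulerOp q = X * (1 - X) * derivative q := rfl

/-- The polynomial `R_k` with
`(x (1 - x) d/dx)^k (x ^ a x ^ m (1 - x) ^ n) = x ^ m (1 - x) ^ n R_k`. -/
noncomputable def cofactor (m n : F) (a : ℕ) : ℕ → F[X]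
  | 0 => X ^ a
  | k + 1 => X * (1 - X) * derivative (cofactor m n a k)
      + (C m * (1 - X) - C n * X) * cofactor m n a k

theorem X_mul_derivative_X_pow (m : ℕ) :
    X * derivative (X ^ m : F[X]) = C (m : F) * X ^ m := by
  rcases m with _ | m
  · simp
  · rw [derivative_X_pow, Nat.add_sub_cancel]; ring

theorem one_sub_X_mul_derivative_pow (n : ℕ) :
    (1 - X) * derivative ((1 - X) ^ n : F[X]) = - (C (n : F) * (1 - X) ^ n) := by
  rcases n with _ | n
  · simp
  · rw [derivative_pow, Nat.add_sub_cancel]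
    simp only [derivative_sub, derivative_one, derivative_X]; ring

/-- The operator multiplies `x^m (1-x)^n` by the linear factor `m(1-x) - nx`, so the large powers
survive differentiation intact. At a point `y` they become constants determined by `(y^t, (1-y)^t)`,
leaving a cofactor of low degree. -/
theorem eulerOp_iterate_monomial (m n a k : ℕ) :
    (eulerOp^[k]) (X ^ a * (X ^ m * (1 - X) ^ n) : F[X])
      = X ^ m * (1 - X) ^ n * cofactor (m : F) (n : F) a k := by
  induction k with
  | zero => simp [cofactor]; ring
  | succ k ih =>
    rw [Function.iterate_succ_apply', ih, eulerOp_apply, derivative_mul, derivative_mul, cofactor]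
    have h1 := X_mul_derivative_X_pow (F := F) m
    have h2 := one_sub_X_mul_derivative_pow (F := F) n
    linear_combination (1 - X) * (1 - X) ^ n * cofactor (m : F) (n : F) a k * h1
      + X * X ^ m * cofactor (m : F) (n : F) a k * h2

theorem natDegree_X_mul_derivative_le (q : F[X]) :
    (X * derivative q).natDegree ≤ q.natDegree := by
  rw [natDegree_le_iff_coeff_eq_zero]
  intro N hN
  rcases N with _ | N
  · simp
  · rw [coeff_X_mul, coeff_derivative, coeff_eq_zero_of_natDegree_lt hN, zero_mul]

theorem natDegree_cofactor_le (m n : F) (a k : ℕ) : (cofactor m n a k).natDegree ≤ a + k := by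
  induction k with
  | zero => simp [cofactor]
  | succ k ih =>
    have hX : (1 - X : F[X]).natDegree ≤ 1 :=
      (natDegree_sub_le _ _).trans (by simp)
    rw [cofactor]
    refine (natDegree_add_le _ _).trans (max_le ?_ ?_)
    · rw [show X * (1 - X) * derivative (cofactor m n a k)
        = (1 - X) * (X * derivative (cofactor m n a k)) by ring]
      have := natDegree_X_mul_derivative_le (cofactor m n a k)
      exact natDegree_mul_le.trans (by omega)
    · refine natDegree_mul_le.trans ?_
      have h3 : (C m * (1 - X) - C n * X : F[X]).natDegree ≤ 1 := by
        refine (natDegree_sub_le _ _).trans (max_le ?_ ?_)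
        · exact (natDegree_C_mul_le _ _).trans hX
        · exact (natDegree_C_mul_le _ _).trans (by simp)
      omega

/-- Each application lowers the order of vanishing at `y` by exactly one, multiplying the leading
value by the current order times `y(1-y)`; this is nonzero while the order is below `p`. -/
theorem eval_eulerOp_iterate_ne_zero {p : ℕ} [Fact p.Prime] [CharP F p] {y : F} (hy : y ≠ 0)
    (hy1 : y ≠ 1) (m : ℕ) (hm : m < p) (q : F[X]) (hq : q.eval y ≠ 0) :
    ((eulerOp^[m]) ((X - C y) ^ m * q)).eval y ≠ 0 := by
  induction m generalizing q with
  | zero => simpa using hq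
  | succ m ih =>
    rw [Function.iterate_succ_apply]
    have : eulerOp ((X - C y) ^ (m + 1) * q)
        = (X - C y) ^ m * (C ((m + 1 : ℕ) : F) * (X * (1 - X)) * q + (X - C y) * eulerOp q) := by
      rw [eulerOp_apply, eulerOp_apply, derivative_mul, derivative_pow, Nat.add_sub_cancel]
      simp only [derivative_sub, derivative_X, derivative_C]
      ring
    rw [this]
    refine ih (by omega) _ ?_
    have hc : ((m + 1 : ℕ) : F) ≠ 0 := by
      rw [Ne, CharP.cast_eq_zero_iff F p]
      exact fun h => absurd (Nat.le_of_dvd (by omega) h) (by omega)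
    have h1 : (1 - y) ≠ 0 := sub_ne_zero.2 (Ne.symm hy1)
    simp only [eval_add, eval_mul, eval_C, eval_X, eval_sub, eval_one, sub_self, zero_mul,
      add_zero]
    exact mul_ne_zero (mul_ne_zero hc (mul_ne_zero hy h1)) hq

/-- A nonzero polynomial all of whose iterates under `x (1 - x) d/dx` of order below `D ≤ p`
vanish at `y ≠ 0, 1` has a root of multiplicity at least `D` at `y`. -/
theorem le_rootMultiplicity_of_eulerOp {p : ℕ} [Fact p.Prime] [CharP F p] {y : F} (hy : y ≠ 0)
    (hy1 : y ≠ 1) {D : ℕ} (hD : D ≤ p) {q : F[X]} (hq : q ≠ 0)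
    (h : ∀ n < D, ((eulerOp^[n]) q).eval y = 0) : D ≤ q.rootMultiplicity y := by
  by_contra! hlt
  obtain ⟨r, hr, hr'⟩ := exists_eq_pow_rootMultiplicity_mul_and_not_dvd q hq y
  refine eval_eulerOp_iterate_ne_zero hy hy1 (q.rootMultiplicity y) (by omega) r ?_ (p := p) ?_
  · rwa [dvd_iff_isRoot] at hr'
  · rw [← hr]; exact h _ hlt

theorem pow_dvd_iterate_X_mul_derivative (y : F) (n j : ℕ) (q : F[X])
    (h : (X - C y) ^ (n + j) ∣ q) :
    (X - C y) ^ n ∣ ((fun r : F[X] => X * derivative r)^[j]) q := by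
  induction j generalizing q with
  | zero => simpa using h
  | succ j ih =>
    rw [Function.iterate_succ_apply]
    refine ih _ ?_
    obtain ⟨r, rfl⟩ := h
    refine Dvd.dvd.mul_left ?_ _
    rw [derivative_mul, derivative_pow, ← add_assoc, Nat.add_sub_cancel]
    refine dvd_add ?_ ?_
    · exact Dvd.intro_left (C ((n + j + 1 : ℕ) : F) * derivative (X - C y) * r) (by ring)
    · exact Dvd.intro_left ((X - C y) * derivative r) (by ring)

theorem coeff_iterate_X_mul_derivative (j i : ℕ) (q : F[X]) :
    (((fun r : F[X] => X * derivative r)^[j]) q).coeff i = (i : F) ^ j * q.coeff i := by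
  induction j generalizing q with
  | zero => simp
  | succ j ih =>
    rw [Function.iterate_succ_apply, ih]
    rcases i with _ | i
    · simp
    · rw [coeff_X_mul, coeff_derivative]; push_cast; ring

/-- A nonzero polynomial of degree below the characteristic vanishes at `1` to an order less than
the number of its terms. -/
theorem lt_card_support_of_pow_dvd {p : ℕ} [CharP F p] {q : F[X]} (hq : q ≠ 0)
    (hdeg : q.natDegree < p) {n : ℕ} (h : (X - C 1) ^ n ∣ q) : n < q.support.card := by
  by_contra! hle
  -- `x d/dx` lowers the order at `1` by at most one, so all moments of the coefficients below the
  -- number of terms vanish. The exponents are distinct modulo `p`, so this is a Vandermonde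
  -- contradiction.
  have hmom : ∀ j < q.support.card, ∑ i ∈ q.support, (i : F) ^ j * q.coeff i = 0 := by
    intro j hj
    have hd := pow_dvd_iterate_X_mul_derivative (1 : F) 1 j q
      ((pow_dvd_pow _ (by omega)).trans h)
    rw [pow_one, dvd_iff_isRoot, IsRoot.def, eval_eq_sum, sum_def] at hd
    simp only [one_pow, mul_one, coeff_iterate_X_mul_derivative] at hd
    rw [← hd]
    symm
    refine Finset.sum_subset ?_ ?_
    · intro i hi
      rw [mem_support_iff, coeff_iterate_X_mul_derivative] at hi
      exact mem_support_iff.2 (right_ne_zero_of_mul hi)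
    · intro i _ hi
      rw [notMem_support_iff, coeff_iterate_X_mul_derivative] at hi
      exact hi
  have hne : q.support.Nonempty := by
    rw [Finset.nonempty_iff_ne_empty, Ne, support_eq_empty]; exact hq
  obtain ⟨i₀, hi₀⟩ := hne
  -- test the moments against the polynomial vanishing on the rest of the support
  set f : F[X] := ∏ i ∈ q.support.erase i₀, (X - C (i : F)) with hf
  have hfdeg : f.natDegree < q.support.card := by
    rw [hf, natDegree_prod_of_monic _ _ (fun i _ => monic_X_sub_C _)]
    simp only [natDegree_X_sub_C, Finset.sum_const, smul_eq_mul, mul_one]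
    exact Finset.card_erase_lt_of_mem hi₀
  have hzero : ∑ i ∈ q.support, f.eval (i : F) * q.coeff i = 0 := by
    simp only [eval_eq_sum_range, Finset.sum_mul]
    rw [Finset.sum_comm]
    refine Finset.sum_eq_zero fun j hj => ?_
    rw [Finset.mem_range] at hj
    simp only [mul_assoc, ← Finset.mul_sum]
    rw [hmom j (by omega), mul_zero]
  rw [Finset.sum_eq_single_of_mem i₀ hi₀] at hzero
  · refine (mul_ne_zero ?_ (mem_support_iff.1 hi₀)) hzero
    rw [hf, eval_prod, Finset.prod_ne_zero_iff]
    intro i hi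
    rw [eval_sub, eval_X, eval_C, sub_ne_zero]
    intro heq
    rw [Finset.mem_erase] at hi
    have h1 := le_natDegree_of_mem_supp i hi.2
    have h2 := le_natDegree_of_mem_supp i₀ hi₀
    exact hi.1 (((CharP.natCast_injOn_Iio F p) (Set.mem_Iio.2 (by omega))
      (Set.mem_Iio.2 (by omega)) heq).symm)
  · intro i hi hne
    rw [hf, eval_prod, Finset.prod_eq_zero (Finset.mem_erase.2 ⟨hne, hi⟩) (by simp), zero_mul]

/-- The auxiliary polynomial `∑ λ_{abc} x ^ a x ^ (tb) (1 - x) ^ (tc)`. -/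
noncomputable def auxPoly (t A B : ℕ) (c : Fin A × Fin B × Fin B → F) : F[X] :=
  ∑ i, C (c i) * (X ^ (i.1 : ℕ) * (X ^ (t * i.2.1) * (1 - X) ^ (t * i.2.2)))

/-- Group the sum by powers of `(1-x)^t`. The lowest nonzero coefficient `f k` would be divisible by
`(1-x)^t`, yet it has at most `A * B ≤ t` terms and degree below `p`. Inside one `f k` the exponents
`a + tb` are distinct because `a < A ≤ t`. -/
theorem eq_zero_of_auxPoly_eq_zero {p t A B : ℕ} [CharP F p] (hA : 0 < A) (hAB : A * B ≤ t)
    (htB : t * B ≤ p) {c : Fin A × Fin B × Fin B → F} (h : auxPoly t A B c = 0) : c = 0 := by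
  rcases Nat.eq_zero_or_pos B with rfl | hB
  · funext i; exact i.2.1.elim0
  have hAt : A ≤ t := (Nat.le_mul_of_pos_right A hB).trans hAB
  set f : Fin B → F[X] := fun k =>
    ∑ i : Fin A × Fin B, C (c (i.1, i.2, k)) * X ^ (i.1 + t * i.2 : ℕ) with hf
  have hsum : ∑ k : Fin B, f k * (1 - X) ^ (t * k) = 0 := by
    rw [← h, auxPoly, Fintype.sum_prod_type]
    simp only [hf, Finset.sum_mul, Fintype.sum_prod_type]
    rw [Finset.sum_comm]
    refine Finset.sum_congr rfl fun a _ => ?_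
    rw [Finset.sum_comm]
    refine Finset.sum_congr rfl fun b _ => Finset.sum_congr rfl fun k _ => ?_
    ring
  have hsupp : ∀ k, (f k).support.card ≤ A * B := by
    intro k
    have : (f k).support ⊆ Finset.univ.image (fun i : Fin A × Fin B => (i.1 + t * i.2 : ℕ)) := by
      intro n hn
      by_contra hn'
      refine (mem_support_iff.1 hn) ?_
      simp only [hf, finsetSum_coeff, coeff_C_mul, coeff_X_pow]
      refine Finset.sum_eq_zero fun i _ => ?_
      rw [if_neg, mul_zero]
      rintro rfl
      exact hn' (Finset.mem_image_of_mem _ (Finset.mem_univ i))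
    refine (Finset.card_le_card this).trans (Finset.card_image_le.trans ?_)
    simp
  have hexp : ∀ i : Fin A × Fin B, (i.1 + t * i.2 : ℕ) < p := by
    intro i
    have h1 := i.1.2
    have h2 : t * i.2 + t ≤ t * B := by rw [← Nat.mul_succ]; exact Nat.mul_le_mul_left _ i.2.2
    omega
  have hdeg : ∀ k, (f k).natDegree < p := by
    intro k
    have hp : 0 < p := lt_of_lt_of_le (Nat.mul_pos (by omega) hB) htB
    refine lt_of_le_of_lt (natDegree_sum_le_of_forall_le (n := p - 1) _ _ fun i _ => ?_) (by omega)
    have := hexp i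
    exact (natDegree_C_mul_X_pow_le _ _).trans (by omega)
  have hfk : ∀ n (hn : n < B), f ⟨n, hn⟩ = 0 := by
    intro n
    induction n using Nat.strong_induction_on with
    | _ n ih =>
      intro hn
      by_contra hne
      have hdvd : (1 - X : F[X]) ^ (t * n) * (1 - X) ^ t ∣ (1 - X) ^ (t * n) * f ⟨n, hn⟩ := by
        rw [← Finset.add_sum_erase _ _ (Finset.mem_univ (⟨n, hn⟩ : Fin B))] at hsum
        rw [mul_comm _ (f ⟨n, hn⟩), eq_neg_of_add_eq_zero_left hsum, dvd_neg]
        refine Finset.dvd_sum fun k hk => ?_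
        rcases lt_trichotomy (k : ℕ) n with hlt | heq | hgt
        · rw [ih k hlt k.2, zero_mul]; exact dvd_zero _
        · exact absurd (Fin.ext heq) (Finset.ne_of_mem_erase hk)
        · rw [← pow_add, ← Nat.mul_succ]
          exact (pow_dvd_pow _ (Nat.mul_le_mul_left _ hgt)).mul_left _
      have hX : (1 - X : F[X]) ≠ 0 := by
        intro h0
        have := congrArg (eval 0) h0
        simp at this
      have hdvd' := (mul_dvd_mul_iff_left (pow_ne_zero _ hX)).1 hdvd
      have hneg : (X - C 1 : F[X]) ^ t ∣ f ⟨n, hn⟩ := by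
        refine dvd_trans ?_ hdvd'
        refine pow_dvd_pow_of_dvd ?_ t
        rw [C_1, ← neg_sub, neg_dvd]
      have := lt_card_support_of_pow_dvd hne (hdeg _) hneg
      have := hsupp ⟨n, hn⟩
      omega
  funext ⟨a, b, k⟩
  have h0 := congrArg (fun q => coeff q (a + t * b : ℕ)) (hfk k k.2)
  simp only [hf, finsetSum_coeff, coeff_C_mul, coeff_X_pow, coeff_zero] at h0
  rw [Finset.sum_eq_single_of_mem (a, b) (Finset.mem_univ _)] at h0
  · simpa using h0
  · rintro ⟨a', b'⟩ _ hne
    rw [if_neg, mul_zero]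
    intro heq
    apply hne
    have ht : 0 < t := by omega
    have ha : (a : ℕ) = a' := by
      have := congrArg (· % t) heq
      simpa [Nat.add_mul_mod_self_left, Nat.mod_eq_of_lt (lt_of_lt_of_le a.2 hAt),
        Nat.mod_eq_of_lt (lt_of_lt_of_le a'.2 hAt)] using this
    have hb : (b : ℕ) = b' := by
      simp only [ha] at heq
      exact Nat.eq_of_mul_eq_mul_left ht (Nat.add_left_cancel heq)
    exact Prod.ext (Fin.ext ha.symm) (Fin.ext hb.symm)

theorem natDegree_auxPoly_le (t A B : ℕ) (c : Fin A × Fin B × Fin B → F) :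
    (auxPoly t A B c).natDegree ≤ A + 2 * t * B := by
  refine natDegree_sum_le_of_forall_le _ _ fun i _ => ?_
  have hX : (1 - X : F[X]).natDegree ≤ 1 := (natDegree_sub_le _ _).trans (by simp)
  refine (natDegree_C_mul_le _ _).trans (natDegree_mul_le.trans ?_)
  have h1 : ((X : F[X]) ^ (t * i.2.1 : ℕ) * (1 - X) ^ (t * i.2.2 : ℕ)).natDegree
      ≤ t * i.2.1 + t * i.2.2 := by
    refine natDegree_mul_le.trans (add_le_add (by simp) ?_)
    exact (natDegree_pow_le_of_le _ hX).trans (by simp)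
  have h2 : t * (i.2.1 : ℕ) ≤ t * B := Nat.mul_le_mul_left _ i.2.1.2.le
  have h3 : t * (i.2.2 : ℕ) ≤ t * B := Nat.mul_le_mul_left _ i.2.2.2.le
  have h4 := i.1.2
  rw [natDegree_X_pow, mul_assoc]
  omega

/-- Stepanov's method: the number of `y` for which `(y ^ t, (1 - y) ^ t)` lies in a given finite
set. -/
theorem stepanov {p : ℕ} [Fact p.Prime] [CharP F p] {t A B : ℕ} (P : Finset (F × F))
    (Y : Finset F) (hY : ∀ y ∈ Y, y ≠ 0 ∧ y ≠ 1 ∧ (y ^ t, (1 - y) ^ t) ∈ P)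
    (hA : 0 < A) (hAB : A * B ≤ t) (htB : t * B ≤ p) (hP : 2 * P.card * A < B ^ 2) :
    A * Y.card ≤ A + 2 * t * B := by
  classical
  -- One equation per pair in `P`, per order `n < A` and per coefficient below `2A`: `2A²|P|`
  -- conditions on `AB²` unknowns.
  let T : (Fin A × Fin B × Fin B → F) →ₗ[F] (P × Fin A × Fin (2 * A) → F) :=
    { toFun := fun c j => ∑ i, c i * (j.1.1.1 ^ (i.2.1 : ℕ) * j.1.1.2 ^ (i.2.2 : ℕ) *
        (cofactor ((t * i.2.1 : ℕ) : F) ((t * i.2.2 : ℕ) : F) i.1 j.2.1).coeff j.2.2)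
      map_add' := fun c d => by
        funext j; simp only [Pi.add_apply, add_mul, Finset.sum_add_distrib]
      map_smul' := fun a c => by
        funext j
        simp only [Pi.smul_apply, smul_eq_mul, RingHom.id_apply, Finset.mul_sum, mul_assoc] }
  obtain ⟨c, hcT, hc⟩ : ∃ c, T c = 0 ∧ c ≠ 0 := by
    have hlt : Module.finrank F (P × Fin A × Fin (2 * A) → F)
        < Module.finrank F (Fin A × Fin B × Fin B → F) := by
      simp only [Module.finrank_fintype_fun_eq_card, Fintype.card_prod, Fintype.card_fin,
        Fintype.card_coe]
      calc P.card * (A * (2 * A)) = A * (2 * P.card * A) := by ring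
        _ < A * B ^ 2 := Nat.mul_lt_mul_of_pos_left hP hA
        _ = A * (B * B) := by ring
    obtain ⟨c, hc, hc0⟩ := (Submodule.ne_bot_iff _).1 (LinearMap.ker_ne_bot_of_finrank_lt hlt (f := T))
    exact ⟨c, hc, hc0⟩
  have hΨ : auxPoly t A B c ≠ 0 := fun h => hc (eq_zero_of_auxPoly_eq_zero hA hAB htB h)
  have hB : 0 < B := by
    rcases Nat.eq_zero_or_pos B with rfl | h
    · simp at hP
    · exact h
  have hAp : A ≤ p := by
    calc A ≤ A * B := Nat.le_mul_of_pos_right _ hB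
      _ ≤ t := hAB
      _ ≤ t * B := Nat.le_mul_of_pos_right _ hB
      _ ≤ p := htB
  have hmult : ∀ y ∈ Y, A ≤ (auxPoly t A B c).rootMultiplicity y := by
    intro y hy
    obtain ⟨hy0, hy1, hyP⟩ := hY y hy
    refine le_rootMultiplicity_of_eulerOp hy0 hy1 hAp hΨ fun n hn => ?_
    have hiter : ∀ q : F[X], (eulerOp^[n]) q = (eulerOp ^ n : F[X] →ₗ[F] F[X]) q := fun q => by
      rw [Module.End.pow_apply]
    have hlin : (eulerOp^[n]) (auxPoly t A B c)
        = ∑ i, C (c i) * (X ^ (t * i.2.1 : ℕ) * (1 - X) ^ (t * i.2.2 : ℕ) *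
          cofactor ((t * i.2.1 : ℕ) : F) ((t * i.2.2 : ℕ) : F) i.1 n) := by
      rw [hiter, auxPoly, map_sum]
      refine Finset.sum_congr rfl fun i _ => ?_
      rw [← smul_eq_C_mul, map_smul, ← hiter, eulerOp_iterate_monomial, smul_eq_C_mul]
    -- `Q` replaces the high powers by their values at `y`, so it agrees at `y` with the iterate.
    -- Its coefficients depend on `y` only through the pair in `P`, and its degree is at most `A - 1
    -- + n < 2A`, so the linear system kills it identically.
    set Q : F[X] := ∑ i, C (c i * ((y ^ t) ^ (i.2.1 : ℕ) * ((1 - y) ^ t) ^ (i.2.2 : ℕ))) *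
      cofactor ((t * i.2.1 : ℕ) : F) ((t * i.2.2 : ℕ) : F) i.1 n with hQ
    have hQ0 : Q = 0 := by
      ext m
      rw [coeff_zero]
      by_cases hm : m < 2 * A
      · have := congrFun hcT (⟨_, hyP⟩, ⟨n, hn⟩, ⟨m, hm⟩)
        rw [hQ, finsetSum_coeff]
        simpa only [T, LinearMap.coe_mk, AddHom.coe_mk, Pi.zero_apply, coeff_C_mul, mul_assoc]
          using this
      · refine coeff_eq_zero_of_natDegree_lt (lt_of_lt_of_le ?_ (not_lt.1 hm))
        refine lt_of_le_of_lt (natDegree_sum_le_of_forall_le (n := A - 1 + n) _ _ fun i _ => ?_)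
          (by omega)
        refine (natDegree_C_mul_le _ _).trans ((natDegree_cofactor_le _ _ _ _).trans ?_)
        have := i.1.2
        omega
    have := congrArg (eval y) hQ0
    rw [hlin, eval_finsetSum]
    rw [hQ, eval_finsetSum, eval_zero] at this
    rw [← this]
    refine Finset.sum_congr rfl fun i _ => ?_
    simp only [eval_mul, eval_C, eval_pow, eval_X, eval_sub, eval_one, pow_mul]
    ring
  calc A * Y.card = ∑ y ∈ Y, A := by rw [Finset.sum_const, smul_eq_mul, mul_comm]
    _ ≤ ∑ y ∈ Y, (auxPoly t A B c).roots.count y :=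
      Finset.sum_le_sum fun y hy => by rw [count_roots]; exact hmult y hy
    _ ≤ Multiset.card (auxPoly t A B c).roots := by
      calc _ ≤ ∑ y ∈ Y ∪ (auxPoly t A B c).roots.toFinset, (auxPoly t A B c).roots.count y :=
            Finset.sum_le_sum_of_subset Finset.subset_union_left
        _ = _ := Multiset.sum_count_eq_card
            (fun y hy => Finset.mem_union_right _ (Multiset.mem_toFinset.2 hy))
    _ ≤ (auxPoly t A B c).natDegree := card_roots' _
    _ ≤ A + 2 * t * B := natDegree_auxPoly_le t A B c

/-- Stepanov's method with the parameters optimised. -/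
theorem stepanov_card_cube_le {p : ℕ} [Fact p.Prime] [CharP F p] {t : ℕ} (ht : 0 < t)
    (P : Finset (F × F)) (hPne : P.Nonempty)
    (Y : Finset F) (hY : ∀ y ∈ Y, y ≠ 0 ∧ y ≠ 1 ∧ (y ^ t, (1 - y) ^ t) ∈ P)
    (h1 : 16 * P.card ≤ t ^ 2) (h2 : 16 * P.card * t ^ 4 ≤ p ^ 3) :
    Y.card ^ 3 ≤ 32000 * (P.card * t) ^ 2 := by
  have hk : 0 < P.card := hPne.card_pos
  set k := P.card with hkdef
  have hex : ∃ B, 2 * k * t < B ^ 3 :=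
    ⟨2 * k * t + 1, lt_of_lt_of_le (Nat.lt_succ_self _) (Nat.le_self_pow (by norm_num) _)⟩
  -- Take `B` minimal with `B³ > 2kt` and `A = ⌊t/B⌋`: then `2kAB ≤ 2kt < B³`. The hypotheses `h1`
  -- and `h2` ensure `B ≤ t`, hence `A > 0`, and `tB ≤ p`.
  obtain ⟨B, hB, hBmin⟩ : ∃ B, 2 * k * t < B ^ 3 ∧ (B - 1) ^ 3 ≤ 2 * k * t := by
    classical
    refine ⟨Nat.find hex, Nat.find_spec hex, ?_⟩
    have h0 : Nat.find hex ≠ 0 := by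
      intro h0
      have := Nat.find_spec hex
      rw [h0] at this; simp at this
    exact not_lt.1 (Nat.find_min hex (by omega))
  have hkt : 0 < k * t := Nat.mul_pos hk ht
  have hB2 : 2 ≤ B := by
    by_contra! hlt
    have : B ^ 3 ≤ 1 ^ 3 := Nat.pow_le_pow_left (by omega) 3
    rw [mul_assoc] at hB
    omega
  have hB16 : B ^ 3 ≤ 16 * (k * t) := by
    calc B ^ 3 ≤ (2 * (B - 1)) ^ 3 := Nat.pow_le_pow_left (by omega) 3
      _ = 8 * (B - 1) ^ 3 := by ring
      _ ≤ 8 * (2 * k * t) := Nat.mul_le_mul_left _ hBmin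
      _ = 16 * (k * t) := by ring
  have hBt : B ≤ t := by
    refine (Nat.pow_le_pow_iff_left (n := 3) (by norm_num)).1 (hB16.trans ?_)
    calc 16 * (k * t) = 16 * k * t := by ring
      _ ≤ t ^ 2 * t := Nat.mul_le_mul_right _ h1
      _ = t ^ 3 := by ring
  have htB : t * B ≤ p := by
    refine (Nat.pow_le_pow_iff_left (n := 3) (by norm_num)).1 (le_trans ?_ h2)
    calc (t * B) ^ 3 = t ^ 3 * B ^ 3 := by ring
      _ ≤ t ^ 3 * (16 * (k * t)) := Nat.mul_le_mul_left _ hB16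
      _ = 16 * k * t ^ 4 := by ring
  have hBpos : 0 < B := by omega
  set A := t / B with hAdef
  have hA : 0 < A := Nat.div_pos hBt hBpos
  have hAB : A * B ≤ t := Nat.div_mul_le_self t B
  have htAB : t ≤ 2 * (A * B) := by
    have h3 := Nat.div_add_mod t B
    have h4 := Nat.mod_lt t hBpos
    rw [← hAdef, mul_comm] at h3
    have : B ≤ A * B := Nat.le_mul_of_pos_left _ hA
    omega
  have hP : 2 * k * A < B ^ 2 := by
    refine lt_of_mul_lt_mul_right (a := B) ?_ (Nat.zero_le _)
    calc 2 * k * A * B = 2 * k * (A * B) := by ring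
      _ ≤ 2 * k * t := Nat.mul_le_mul_left _ hAB
      _ < B ^ 3 := hB
      _ = B ^ 2 * B := by ring
  have hmain := stepanov P Y hY hA hAB htB hP
  have hcard : Y.card ≤ 5 * B ^ 2 := by
    refine Nat.le_of_mul_le_mul_left (hmain.trans ?_) hA
    have e1 : 2 * t * B ≤ 2 * (2 * (A * B)) * B :=
      Nat.mul_le_mul_right _ (Nat.mul_le_mul_left _ htAB)
    have e2 : A * 1 ≤ A * B ^ 2 := Nat.mul_le_mul_left _ (Nat.one_le_pow _ _ hBpos)
    calc A + 2 * t * B ≤ A * B ^ 2 + 2 * (2 * (A * B)) * B := by omega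
      _ = A * (5 * B ^ 2) := by ring
  calc Y.card ^ 3 ≤ (5 * B ^ 2) ^ 3 := Nat.pow_le_pow_left hcard 3
    _ = 125 * (B ^ 3) ^ 2 := by ring
    _ ≤ 125 * (16 * (k * t)) ^ 2 := Nat.mul_le_mul_left _ (Nat.pow_le_pow_left hB16 2)
    _ = 32000 * (k * t) ^ 2 := by ring

end Stepanov

/-! ### Difference counts and their Fourier expansion. -/

section Fourier

variable {p : ℕ} [Fact p.Prime]

/-- The number of representations `x = z - y` with `y, z ∈ A`. -/
def diffCount (A : Finset (ZMod p)) (x : ZMod p) : ℕ := {y ∈ A | y + x ∈ A}.card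

theorem corr_char_eq_diffCount (A : Finset (ZMod p)) (x : ZMod p) :
    corr (char (A : Set (ZMod p))) (char (A : Set (ZMod p))) x = diffCount A x := by
  classical
  simp only [corr, char, diffCount, Set.indicator_apply, Finset.mem_coe, Pi.one_apply,
    Finset.card_filter, Nat.cast_sum, Nat.cast_ite, Nat.cast_one, Nat.cast_zero, ite_mul, one_mul,
    zero_mul]
  rw [← Finset.sum_filter]
  congr 1
  ext y
  simp

/-- The Fourier transform of the indicator function of `A`. -/
noncomputable def dft (A : Finset (ZMod p)) (ξ : ZMod p) : ℂ := ∑ x ∈ A, ZMod.stdAddChar (x * ξ)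

/-- The Fourier transform of the correlation of `A` with itself, divided by `p`. -/
noncomputable def spec (A : Finset (ZMod p)) (ξ : ZMod p) : ℝ := ‖dft A ξ‖ ^ 2 / p

/-- The deviation of `diffCount A` from its average. -/
noncomputable def dev (A : Finset (ZMod p)) (x : ZMod p) : ℝ := diffCount A x - (A.card : ℝ) ^ 2 / p

theorem natCast_pos_of_prime : (0 : ℝ) < p := Nat.cast_pos.2 (Fact.out : p.Prime).pos

theorem spec_nonneg (A : Finset (ZMod p)) (ξ : ZMod p) : 0 ≤ spec A ξ := by
  unfold spec; positivity

theorem sum_stdAddChar_mul (b : ZMod p) :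
    ∑ x : ZMod p, (ZMod.stdAddChar (x * b) : ℂ) = if b = 0 then (p : ℂ) else 0 := by
  rw [AddChar.sum_mulShift b (ZMod.isPrimitive_stdAddChar p), ZMod.card]
  split_ifs <;> simp

/-- Fourier inversion: the transform of an autocorrelation is a squared modulus, so all coefficients
are nonnegative. -/
theorem diffCount_eq_sum_spec (A : Finset (ZMod p)) (x : ZMod p) :
    (diffCount A x : ℂ) = ∑ ξ, (spec A ξ : ℂ) * ZMod.stdAddChar (x * ξ) := by
  have hp : (p : ℂ) ≠ 0 := Nat.cast_ne_zero.2 (Fact.out : p.Prime).ne_zero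
  have hspec : ∀ ξ, (spec A ξ : ℂ) * ZMod.stdAddChar (x * ξ)
      = (∑ y ∈ A, ∑ z ∈ A, ZMod.stdAddChar (ξ * (y + x - z))) / p := by
    intro ξ
    have : ((‖dft A ξ‖ ^ 2 : ℝ) : ℂ) = dft A ξ * (starRingEnd ℂ) (dft A ξ) := by
      rw [Complex.mul_conj, Complex.normSq_eq_norm_sq]
    rw [spec, Complex.ofReal_div, this, dft, map_sum, Finset.sum_mul_sum, Complex.ofReal_natCast,
      div_mul_eq_mul_div, Finset.sum_mul]
    congr 1
    refine Finset.sum_congr rfl fun y _ => ?_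
    rw [Finset.sum_mul]
    refine Finset.sum_congr rfl fun z _ => ?_
    rw [← AddChar.map_neg_eq_conj, ← AddChar.map_add_eq_mul, ← AddChar.map_add_eq_mul]
    congr 1; ring
  simp only [hspec]
  rw [← Finset.sum_div, Finset.sum_comm, eq_div_iff hp]
  have : ∀ y, ∑ ξ : ZMod p, ∑ z ∈ A, (ZMod.stdAddChar (ξ * (y + x - z)) : ℂ)
      = if y + x ∈ A then (p : ℂ) else 0 := by
    intro y
    rw [Finset.sum_comm]
    simp only [sum_stdAddChar_mul, sub_eq_zero]
    rw [Finset.sum_ite_eq]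
  simp only [this]
  rw [← Finset.sum_filter, Finset.sum_const, nsmul_eq_mul, diffCount]

theorem diffCount_zero (A : Finset (ZMod p)) : diffCount A 0 = A.card := by
  simp [diffCount]

theorem diffCount_le_card (A : Finset (ZMod p)) (x : ZMod p) : diffCount A x ≤ A.card :=
  Finset.card_filter_le _ _

theorem sum_spec (A : Finset (ZMod p)) : ∑ ξ, spec A ξ = A.card := by
  have := diffCount_eq_sum_spec A 0
  simp only [zero_mul, AddChar.map_zero_eq_one, mul_one, diffCount_zero] at this
  exact_mod_cast this.symm

theorem spec_zero (A : Finset (ZMod p)) : spec A 0 = (A.card : ℝ) ^ 2 / p := by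
  simp [spec, dft]

theorem sum_erase_spec_le (A : Finset (ZMod p)) :
    ∑ ξ ∈ Finset.univ.erase (0 : ZMod p), spec A ξ ≤ A.card := by
  rw [← sum_spec A]
  exact Finset.sum_le_sum_of_subset_of_nonneg (Finset.erase_subset _ _)
    fun i _ _ => spec_nonneg A i

theorem dev_eq_sum (A : Finset (ZMod p)) (x : ZMod p) :
    (dev A x : ℂ) = ∑ ξ ∈ Finset.univ.erase 0, (spec A ξ : ℂ) * ZMod.stdAddChar (x * ξ) := by
  have := diffCount_eq_sum_spec A x
  rw [← Finset.add_sum_erase _ _ (Finset.mem_univ (0 : ZMod p)), spec_zero] at this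
  simp only [mul_zero, AddChar.map_zero_eq_one, mul_one] at this
  rw [dev, Complex.ofReal_sub, Complex.ofReal_natCast, this]
  ring

theorem sum_diffCount (A : Finset (ZMod p)) : ∑ x, diffCount A x = A.card ^ 2 := by
  simp only [diffCount, Finset.card_filter]
  rw [Finset.sum_comm]
  have : ∀ y ∈ A, ∑ x : ZMod p, (if y + x ∈ A then 1 else 0) = A.card := by
    intro y _
    refine (Equiv.sum_comp (Equiv.addLeft y) (fun z => if z ∈ A then 1 else 0)).trans ?_
    simp
  rw [Finset.sum_congr rfl this, Finset.sum_const, smul_eq_mul, sq]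

theorem sum_dev (A : Finset (ZMod p)) : ∑ x, dev A x = 0 := by
  have hp := (natCast_pos_of_prime (p := p)).ne'
  simp only [dev, Finset.sum_sub_distrib, Finset.sum_const, Finset.card_univ, ZMod.card,
    nsmul_eq_mul]
  rw [← Nat.cast_sum, sum_diffCount]
  field_simp
  push_cast; ring

/-- Parseval; removing the average removes exactly the zero frequency. -/
theorem sum_dev_mul_dev (A B : Finset (ZMod p)) :
    ∑ x, dev A x * dev B x = p * ∑ ξ ∈ Finset.univ.erase 0, spec A ξ * spec B ξ := by
  rw [← Complex.ofReal_inj]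
  push_cast
  have hB : ∀ x, (dev B x : ℂ)
      = ∑ ξ ∈ Finset.univ.erase 0, (spec B ξ : ℂ) * ZMod.stdAddChar (-(x * ξ)) := by
    intro x
    rw [← Complex.conj_ofReal, dev_eq_sum, map_sum]
    simp only [map_mul, Complex.conj_ofReal, AddChar.map_neg_eq_conj]
  simp only [hB]
  simp only [dev_eq_sum, Finset.sum_mul_sum]
  rw [Finset.sum_comm, Finset.mul_sum]
  refine Finset.sum_congr rfl fun ξ hξ => ?_
  rw [Finset.sum_comm]
  have : ∀ η, ∑ x : ZMod p, (spec A ξ : ℂ) * ZMod.stdAddChar (x * ξ) *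
      ((spec B η : ℂ) * ZMod.stdAddChar (-(x * η)))
      = if ξ = η then (p : ℂ) * (spec A ξ * spec B η) else 0 := by
    intro η
    have h1 : ∀ x : ZMod p, (spec A ξ : ℂ) * ZMod.stdAddChar (x * ξ) *
      ((spec B η : ℂ) * ZMod.stdAddChar (-(x * η)))
        = (spec A ξ * spec B η) * ZMod.stdAddChar (x * (ξ - η)) := by
      intro x
      rw [mul_sub, sub_eq_add_neg, AddChar.map_add_eq_mul]; ring
    simp only [h1]
    rw [← Finset.mul_sum, sum_stdAddChar_mul]
    simp only [sub_eq_zero]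
    split_ifs <;> ring
  simp only [this]
  rw [Finset.sum_ite_eq, if_pos hξ]

theorem dev_zero_nonneg (A : Finset (ZMod p)) : 0 ≤ dev A 0 := by
  have h : (A.card : ℝ) ≤ p := by
    exact_mod_cast (Finset.card_le_univ A).trans (ZMod.card p).le
  have hp := natCast_pos_of_prime (p := p)
  rw [dev, diffCount_zero, sub_nonneg, div_le_iff₀ hp, sq]
  exact mul_le_mul_of_nonneg_left h (Nat.cast_nonneg _)

theorem dev_le_diffCount (A : Finset (ZMod p)) (x : ZMod p) : dev A x ≤ diffCount A x := by
  rw [dev]; simp only [sub_le_self_iff]; positivity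

theorem dev_zero_le (A : Finset (ZMod p)) : dev A 0 ≤ A.card := by
  simpa [diffCount_zero] using dev_le_diffCount A 0

theorem neg_le_dev (A : Finset (ZMod p)) (x : ZMod p) : -((A.card : ℝ) ^ 2 / p) ≤ dev A x := by
  rw [dev]
  have : (0 : ℝ) ≤ diffCount A x := Nat.cast_nonneg _
  linarith

end Fourier

/-! ### Invariant sets: spectral bounds and the cubic moment. -/

section Invariant

variable {p : ℕ} [Fact p.Prime] {G S : Finset (ZMod p)}

theorem one_mem_of_mem_iff (hG : ∀ x, x ∈ G ↔ x ^ G.card = 1) : (1 : ZMod p) ∈ G :=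
  (hG 1).2 (one_pow _)

theorem card_pos_of_mem_iff (hG : ∀ x, x ∈ G ↔ x ^ G.card = 1) : 0 < G.card :=
  Finset.card_pos.2 ⟨1, one_mem_of_mem_iff hG⟩

theorem ne_zero_of_mem (hG : ∀ x, x ∈ G ↔ x ^ G.card = 1) {γ : ZMod p} (hγ : γ ∈ G) : γ ≠ 0 := by
  rintro rfl
  rw [hG, zero_pow (card_pos_of_mem_iff hG).ne'] at hγ
  exact zero_ne_one hγ

theorem mul_mem_of_mem (hG : ∀ x, x ∈ G ↔ x ^ G.card = 1) :
    ∀ γ ∈ G, ∀ x ∈ G, γ * x ∈ G := by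
  intro γ hγ x hx
  rw [hG] at *
  rw [mul_pow, hγ, hx, one_mul]

theorem div_mem_of_mem (hG : ∀ x, x ∈ G ↔ x ^ G.card = 1) :
    ∀ γ ∈ G, ∀ x ∈ G, x / γ ∈ G := by
  intro γ hγ x hx
  rw [hG] at *
  rw [div_pow, hγ, hx, div_one]

theorem image_mul_eq (hG : ∀ x, x ∈ G ↔ x ^ G.card = 1) (hS : ∀ γ ∈ G, ∀ x ∈ S, γ * x ∈ S)
    {γ : ZMod p} (hγ : γ ∈ G) : S.image (γ * ·) = S := by
  refine Finset.eq_of_subset_of_card_le ?_ ?_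
  · intro y hy
    obtain ⟨x, hx, rfl⟩ := Finset.mem_image.1 hy
    exact hS γ hγ x hx
  · rw [Finset.card_image_of_injective _ (mul_right_injective₀ (ne_zero_of_mem hG hγ))]

theorem dft_mul (hG : ∀ x, x ∈ G ↔ x ^ G.card = 1) (hS : ∀ γ ∈ G, ∀ x ∈ S, γ * x ∈ S)
    {γ : ZMod p} (hγ : γ ∈ G) (ξ : ZMod p) : dft S (γ * ξ) = dft S ξ := by
  conv_rhs => rw [dft, ← image_mul_eq hG hS hγ,
    Finset.sum_image fun x _ y _ h => mul_right_injective₀ (ne_zero_of_mem hG hγ) h]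
  refine Finset.sum_congr rfl fun x _ => ?_
  congr 1; ring

theorem spec_mul (hG : ∀ x, x ∈ G ↔ x ^ G.card = 1) (hS : ∀ γ ∈ G, ∀ x ∈ S, γ * x ∈ S)
    {γ : ZMod p} (hγ : γ ∈ G) (ξ : ZMod p) : spec S (γ * ξ) = spec S ξ := by
  rw [spec, spec, dft_mul hG hS hγ]

/-- The spectrum is constant on the `|G|` distinct frequencies of the orbit of `ξ`, and its total
mass is `|S|`. -/
theorem card_mul_spec_le (hG : ∀ x, x ∈ G ↔ x ^ G.card = 1) (hS : ∀ γ ∈ G, ∀ x ∈ S, γ * x ∈ S)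
    {ξ : ZMod p} (hξ : ξ ≠ 0) : G.card * spec S ξ ≤ S.card := by
  calc (G.card : ℝ) * spec S ξ = ∑ γ ∈ G, spec S (γ * ξ) := by
        rw [Finset.sum_congr rfl fun γ hγ => spec_mul hG hS hγ ξ, Finset.sum_const, nsmul_eq_mul]
    _ = ∑ η ∈ G.image (· * ξ), spec S η := by
        rw [Finset.sum_image fun x _ y _ h => mul_left_injective₀ hξ h]
    _ ≤ ∑ η, spec S η := Finset.sum_le_sum_of_subset_of_nonneg (Finset.subset_univ _)
        fun i _ _ => spec_nonneg S i
    _ = S.card := sum_spec S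

theorem norm_dft_sq_le (hG : ∀ x, x ∈ G ↔ x ^ G.card = 1) {ξ : ZMod p} (hξ : ξ ≠ 0) :
    ‖dft G ξ‖ ^ 2 ≤ p := by
  have h := card_mul_spec_le hG (mul_mem_of_mem hG) hξ
  have ht : (0 : ℝ) < G.card := Nat.cast_pos.2 (card_pos_of_mem_iff hG)
  have h1 : spec G ξ ≤ 1 := by
    by_contra! hlt
    nlinarith
  rwa [spec, div_le_one natCast_pos_of_prime] at h1

variable {M : ℝ}

/-- Averaging over the orbit of `ξ` and exchanging sums turns the transform of `S` into a sum of
transforms of `G` at the nonzero points `x * ξ`. -/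
theorem card_mul_norm_dft_le (hG : ∀ x, x ∈ G ↔ x ^ G.card = 1)
    (hS : ∀ γ ∈ G, ∀ x ∈ S, γ * x ∈ S) (hS0 : 0 ∉ S) (hM : ∀ ξ ≠ 0, ‖dft G ξ‖ ≤ M)
    {ξ : ZMod p} (hξ : ξ ≠ 0) : G.card * ‖dft S ξ‖ ≤ S.card * M := by
  have h : (G.card : ℂ) * dft S ξ = ∑ x ∈ S, dft G (x * ξ) := by
    calc (G.card : ℂ) * dft S ξ = ∑ γ ∈ G, dft S (γ * ξ) := by
          rw [Finset.sum_congr rfl fun γ hγ => dft_mul hG hS hγ ξ, Finset.sum_const, nsmul_eq_mul]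
      _ = ∑ x ∈ S, dft G (x * ξ) := by
          simp only [dft]
          rw [Finset.sum_comm]
          refine Finset.sum_congr rfl fun x _ => Finset.sum_congr rfl fun γ _ => ?_
          congr 1; ring
  calc (G.card : ℝ) * ‖dft S ξ‖ = ‖(G.card : ℂ) * dft S ξ‖ := by simp
    _ ≤ ∑ x ∈ S, ‖dft G (x * ξ)‖ := by rw [h]; exact norm_sum_le _ _
    _ ≤ ∑ x ∈ S, M := Finset.sum_le_sum fun x hx =>
        hM _ (mul_ne_zero (fun h0 => hS0 (h0 ▸ hx)) hξ)
    _ = S.card * M := by rw [Finset.sum_const, nsmul_eq_mul]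

/-- `spec S` is invariant under dilation by `G`, so averaging the Fourier expansion over dilations
replaces each character by a transform of `G`. -/
theorem card_mul_dev_eq (hG : ∀ x, x ∈ G ↔ x ^ G.card = 1) (hS : ∀ γ ∈ G, ∀ x ∈ S, γ * x ∈ S)
    (x : ZMod p) :
    (G.card : ℂ) * dev S x = ∑ ξ ∈ Finset.univ.erase 0, (spec S ξ : ℂ) * dft G (x * ξ) := by
  have h : ∀ γ ∈ G, (dev S x : ℂ)
      = ∑ ξ ∈ Finset.univ.erase 0, (spec S ξ : ℂ) * ZMod.stdAddChar (γ * (x * ξ)) := by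
    intro γ hγ
    have hγ0 := ne_zero_of_mem hG hγ
    rw [dev_eq_sum]
    symm
    refine Finset.sum_bij (fun ξ _ => γ * ξ) ?_ ?_ ?_ ?_
    · intro ξ hξ
      simpa [hγ0] using hξ
    · intro a _ b _ hab; exact mul_right_injective₀ hγ0 hab
    · intro b hb
      refine ⟨γ⁻¹ * b, by simpa [hγ0] using hb, ?_⟩
      rw [mul_inv_cancel_left₀ hγ0]
    · intro ξ _
      rw [spec_mul hG hS hγ]
      congr 2; ring
  rw [← nsmul_eq_mul, ← Finset.sum_const, Finset.sum_congr rfl h, Finset.sum_comm]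
  simp only [dft, Finset.mul_sum]

theorem card_mul_abs_dev_le (hG : ∀ x, x ∈ G ↔ x ^ G.card = 1)
    (hS : ∀ γ ∈ G, ∀ x ∈ S, γ * x ∈ S) (hM : ∀ ξ ≠ 0, ‖dft G ξ‖ ≤ M) (hM0 : 0 ≤ M)
    {x : ZMod p} (hx : x ≠ 0) : G.card * |dev S x| ≤ S.card * M := by
  calc (G.card : ℝ) * |dev S x| = ‖(G.card : ℂ) * dev S x‖ := by simp
    _ ≤ ∑ ξ ∈ Finset.univ.erase 0, ‖(spec S ξ : ℂ) * dft G (x * ξ)‖ := by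
        rw [card_mul_dev_eq hG hS]; exact norm_sum_le _ _
    _ ≤ ∑ ξ ∈ Finset.univ.erase 0, spec S ξ * M := by
        refine Finset.sum_le_sum fun ξ hξ => ?_
        rw [norm_mul, Complex.norm_real, Real.norm_of_nonneg (spec_nonneg _ _)]
        exact mul_le_mul_of_nonneg_left (hM _ (mul_ne_zero hx (Finset.ne_of_mem_erase hξ)))
          (spec_nonneg _ _)
    _ ≤ S.card * M := by
        rw [← Finset.sum_mul]
        exact mul_le_mul_of_nonneg_right (sum_erase_spec_le S) hM0

/-- In Parseval, one spectrum is bounded by its supremum and the other by its total mass. -/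
theorem sum_dev_sq_le {w : ℝ} (A B : Finset (ZMod p)) (hw : ∀ ξ ≠ 0, p * spec A ξ ≤ w) :
    ∑ x, dev A x * dev B x ≤ w * B.card := by
  have hw0 : 0 ≤ w := by
    obtain ⟨ξ, hξ⟩ := exists_ne (0 : ZMod p)
    exact le_trans (mul_nonneg (natCast_pos_of_prime).le (spec_nonneg A ξ)) (hw ξ hξ)
  rw [sum_dev_mul_dev, Finset.mul_sum]
  calc ∑ ξ ∈ Finset.univ.erase 0, (p : ℝ) * (spec A ξ * spec B ξ)
      ≤ ∑ ξ ∈ Finset.univ.erase 0, w * spec B ξ := by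
        refine Finset.sum_le_sum fun ξ hξ => ?_
        rw [← mul_assoc]
        exact mul_le_mul_of_nonneg_right (hw ξ (Finset.ne_of_mem_erase hξ)) (spec_nonneg _ _)
    _ ≤ w * B.card := by
        rw [← Finset.mul_sum]
        exact mul_le_mul_of_nonneg_left (sum_erase_spec_le B) hw0

theorem sum_dev_mul_dev_nonneg (A B : Finset (ZMod p)) : 0 ≤ ∑ x, dev A x * dev B x := by
  rw [sum_dev_mul_dev]
  exact mul_nonneg natCast_pos_of_prime.le
    (Finset.sum_nonneg fun ξ _ => mul_nonneg (spec_nonneg _ _) (spec_nonneg _ _))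

/-- The number of solutions of `α ξ + β η + γ ζ = 0` with `α, β, γ ∈ G`. -/
def relationCount (G : Finset (ZMod p)) (ξ η ζ : ZMod p) : ℕ :=
  {q ∈ G ×ˢ G ×ˢ G | q.1 * ξ + q.2.1 * η + q.2.2 * ζ = 0}.card

theorem sum_dft_mul_dft_mul_dft (G : Finset (ZMod p)) (ξ η ζ : ZMod p) :
    ∑ x : ZMod p, dft G (x * ξ) * dft G (x * η) * dft G (x * ζ)
      = p * relationCount G ξ η ζ := by
  have h : ∀ x : ZMod p, dft G (x * ξ) * dft G (x * η) * dft G (x * ζ)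
      = ∑ q ∈ G ×ˢ G ×ˢ G,
        (ZMod.stdAddChar (x * (q.1 * ξ + q.2.1 * η + q.2.2 * ζ)) : ℂ) := by
    intro x
    simp only [dft]
    rw [Finset.sum_mul_sum, Finset.sum_mul, Finset.sum_product]
    refine Finset.sum_congr rfl fun a _ => ?_
    rw [Finset.sum_mul, Finset.sum_product]
    refine Finset.sum_congr rfl fun b _ => ?_
    rw [Finset.mul_sum]
    refine Finset.sum_congr rfl fun c _ => ?_
    rw [← AddChar.map_add_eq_mul, ← AddChar.map_add_eq_mul]
    congr 1; ring
  simp only [h]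
  rw [Finset.sum_comm]
  simp only [sum_stdAddChar_mul]
  rw [← Finset.sum_filter, Finset.sum_const, nsmul_eq_mul, relationCount, mul_comm]

/-- Cube the averaged expansion of `dev S`; summing over `x` leaves `p` times relation counts with
nonnegative weights, whose total is at most `|S|³`. -/
theorem abs_sum_dev_cube_le (hG : ∀ x, x ∈ G ↔ x ^ G.card = 1)
    (hS : ∀ γ ∈ G, ∀ x ∈ S, γ * x ∈ S) {N : ℝ}
    (hN : ∀ ξ ≠ 0, ∀ η ≠ 0, ∀ ζ ≠ 0, (relationCount G ξ η ζ : ℝ) ≤ N) (hN0 : 0 ≤ N) :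
    (G.card : ℝ) ^ 3 * |∑ x, dev S x ^ 3| ≤ p * N * (S.card : ℝ) ^ 3 := by
  have h : (G.card : ℂ) ^ 3 * ((∑ x, dev S x ^ 3 : ℝ) : ℂ)
      = ∑ ξ ∈ Finset.univ.erase 0, ∑ η ∈ Finset.univ.erase 0, ∑ ζ ∈ Finset.univ.erase 0,
        ((spec S ξ * spec S η * spec S ζ * (p * relationCount G ξ η ζ) : ℝ) : ℂ) := by
    push_cast
    rw [Finset.mul_sum]
    have h1 : ∀ x, (G.card : ℂ) ^ 3 * (dev S x : ℂ) ^ 3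
        = ∑ ξ ∈ Finset.univ.erase 0, ∑ η ∈ Finset.univ.erase 0, ∑ ζ ∈ Finset.univ.erase 0,
          (spec S ξ * spec S η * spec S ζ : ℂ) *
            (dft G (x * ξ) * dft G (x * η) * dft G (x * ζ)) := by
      intro x
      rw [← mul_pow, card_mul_dev_eq hG hS, pow_succ, sq, Finset.sum_mul_sum, Finset.sum_mul]
      refine Finset.sum_congr rfl fun ξ _ => ?_
      rw [Finset.sum_mul_sum]
      refine Finset.sum_congr rfl fun η _ => Finset.sum_congr rfl fun ζ _ => ?_
      ring
    simp only [h1]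
    rw [Finset.sum_comm]
    refine Finset.sum_congr rfl fun ξ _ => ?_
    rw [Finset.sum_comm]
    refine Finset.sum_congr rfl fun η _ => ?_
    rw [Finset.sum_comm]
    refine Finset.sum_congr rfl fun ζ _ => ?_
    rw [← Finset.mul_sum, sum_dft_mul_dft_mul_dft]
  have hp := natCast_pos_of_prime (p := p)
  rw [← Nat.abs_cast G.card, ← abs_pow, ← abs_mul]
  have hreal : (G.card : ℝ) ^ 3 * (∑ x, dev S x ^ 3)
      = ∑ ξ ∈ Finset.univ.erase 0, ∑ η ∈ Finset.univ.erase 0, ∑ ζ ∈ Finset.univ.erase 0,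
        (spec S ξ * spec S η * spec S ζ * (p * relationCount G ξ η ζ) : ℝ) := by
    exact_mod_cast h
  rw [hreal, abs_of_nonneg]
  · calc _ ≤ ∑ ξ ∈ Finset.univ.erase 0, ∑ η ∈ Finset.univ.erase 0, ∑ ζ ∈ Finset.univ.erase 0,
          (spec S ξ * spec S η * spec S ζ * (p * N) : ℝ) := by
          refine Finset.sum_le_sum fun ξ hξ => Finset.sum_le_sum fun η hη =>
            Finset.sum_le_sum fun ζ hζ => ?_
          refine mul_le_mul_of_nonneg_left (mul_le_mul_of_nonneg_left ?_ hp.le)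
            (mul_nonneg (mul_nonneg (spec_nonneg _ _) (spec_nonneg _ _)) (spec_nonneg _ _))
          exact hN _ (Finset.ne_of_mem_erase hξ) _ (Finset.ne_of_mem_erase hη) _
            (Finset.ne_of_mem_erase hζ)
      _ = (p * N) * (∑ ξ ∈ Finset.univ.erase 0, spec S ξ) ^ 3 := by
          rw [pow_succ, sq, Finset.sum_mul_sum, Finset.sum_mul, Finset.mul_sum]
          refine Finset.sum_congr rfl fun ξ _ => ?_
          rw [Finset.sum_mul_sum, Finset.mul_sum]
          refine Finset.sum_congr rfl fun η _ => ?_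
          rw [Finset.mul_sum]
          refine Finset.sum_congr rfl fun ζ _ => ?_
          ring
      _ ≤ p * N * (S.card : ℝ) ^ 3 := by
          refine mul_le_mul_of_nonneg_left (pow_le_pow_left₀
            (Finset.sum_nonneg fun i _ => spec_nonneg _ _) (sum_erase_spec_le S) 3) (by positivity)
  · refine Finset.sum_nonneg fun ξ _ => Finset.sum_nonneg fun η _ => Finset.sum_nonneg fun ζ _ => ?_
    have h1 := spec_nonneg S ξ
    have h2 := spec_nonneg S η
    have h3 := spec_nonneg S ζ
    positivity

end Invariant

/-! ### Popular differences and linear relations in a subgroup. -/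

section WeakType

variable {p : ℕ} [Fact p.Prime] {G : Finset (ZMod p)}

theorem diffCount_mul (hG : ∀ x, x ∈ G ↔ x ^ G.card = 1) {γ : ZMod p} (hγ : γ ∈ G)
    (x : ZMod p) : diffCount G (γ * x) = diffCount G x := by
  symm
  refine Finset.card_bij (fun y _ => γ * y) ?_ ?_ ?_
  · intro y hy
    rw [Finset.mem_filter] at hy ⊢
    rw [← mul_add]
    exact ⟨mul_mem_of_mem hG γ hγ _ hy.1, mul_mem_of_mem hG γ hγ _ hy.2⟩
  · intro a _ b _ hab; exact mul_right_injective₀ (ne_zero_of_mem hG hγ) hab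
  · intro b hb
    have hγ0 := ne_zero_of_mem hG hγ
    rw [Finset.mem_filter] at hb
    refine ⟨b / γ, ?_, mul_div_cancel₀ _ hγ0⟩
    rw [Finset.mem_filter]
    refine ⟨div_mem_of_mem hG γ hγ b hb.1, ?_⟩
    have := div_mem_of_mem hG γ hγ _ hb.2
    rwa [add_div, mul_div_cancel_left₀ _ hγ0] at this

/-- The elements `y ≠ 0, 1` for which `(y ^ t, (1 - y) ^ t) ∈ P`. -/
def powerPairs (t : ℕ) (P : Finset (ZMod p × ZMod p)) : Finset (ZMod p) :=
  {y | y ≠ 0 ∧ y ≠ 1 ∧ (y ^ t, (1 - y) ^ t) ∈ P}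

/-- Drops the requirement `16k ≤ t²` from Stepanov: when it fails, the trivial bound `p ≤ κt²` is
strong enough. -/
theorem powerPairs_card_cube_le {t : ℕ} (ht : 0 < t) {κ : ℝ} (hp : (p : ℝ) ≤ κ * (t : ℝ) ^ 2)
    {P : Finset (ZMod p × ZMod p)} (hPne : P.Nonempty) (hP : 16 * P.card * t ^ 4 ≤ p ^ 3) :
    ((powerPairs t P).card : ℝ) ^ 3 ≤ (32000 + 256 * κ ^ 3) * ((P.card : ℝ) * t) ^ 2 := by
  have hp0 := natCast_pos_of_prime (p := p)
  have ht0 : (0 : ℝ) < t := Nat.cast_pos.2 ht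
  have hκ : 0 < κ := pos_of_mul_pos_left (hp0.trans_le hp) (by positivity)
  by_cases h1 : 16 * P.card ≤ t ^ 2
  · have := stepanov_card_cube_le (p := p) ht P hPne (powerPairs t P)
      (fun y hy => by simpa [powerPairs] using hy) h1 hP
    have h2 : ((powerPairs t P).card : ℝ) ^ 3 ≤ 32000 * ((P.card : ℝ) * t) ^ 2 := by
      exact_mod_cast this
    refine h2.trans (mul_le_mul_of_nonneg_right ?_ (by positivity))
    have : 0 < κ ^ 3 := by positivity
    linarith
  · have h2 : (t : ℝ) ^ 2 ≤ 16 * P.card := by exact_mod_cast (not_le.1 h1).le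
    have h3 : ((powerPairs t P).card : ℝ) ≤ p := by
      exact_mod_cast (Finset.card_le_univ _).trans (ZMod.card p).le
    calc ((powerPairs t P).card : ℝ) ^ 3 ≤ (κ * (t : ℝ) ^ 2) ^ 3 :=
          pow_le_pow_left₀ (Nat.cast_nonneg _) (h3.trans hp) 3
      _ = κ ^ 3 * (t : ℝ) ^ 2 * ((t : ℝ) ^ 2) ^ 2 := by ring
      _ ≤ κ ^ 3 * (t : ℝ) ^ 2 * (16 * P.card) ^ 2 :=
          mul_le_mul_of_nonneg_left (pow_le_pow_left₀ (by positivity) h2 2) (by positivity)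
      _ = 256 * κ ^ 3 * ((P.card : ℝ) * t) ^ 2 := by ring
      _ ≤ _ := mul_le_mul_of_nonneg_right (by linarith) (by positivity)

/-- The invariants of the coset `ξ G` that enter Stepanov's method. -/
def cosetPair (t : ℕ) (ξ : ZMod p) : ZMod p × ZMod p := ((-ξ⁻¹) ^ t, ξ⁻¹ ^ t)

/-- Send `(ξ, x)` with `x, x + ξ ∈ G` to `y = -x/ξ`. Then `1 - y = (x + ξ)/ξ`, so the powers of `y`
and `1 - y` form `cosetPair` of `ξ`; given `y`, the element `x ∈ G` determines `ξ`. -/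
theorem sum_diffCount_le_card_mul (hG : ∀ x, x ∈ G ↔ x ^ G.card = 1) {D : Finset (ZMod p)}
    (hD0 : 0 ∉ D) {P : Finset (ZMod p × ZMod p)} (hD : ∀ ξ ∈ D, cosetPair G.card ξ ∈ P) :
    ∑ ξ ∈ D, diffCount G ξ ≤ G.card * (powerPairs G.card P).card := by
  have hsig : ∑ ξ ∈ D, diffCount G ξ
      = (D.sigma fun ξ => {x ∈ G | x + ξ ∈ G}).card := by
    rw [Finset.card_sigma]; rfl
  rw [hsig]
  refine Finset.card_le_mul_card_image_of_maps_to (f := fun q => -q.2 / q.1) ?_ _ ?_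
  · rintro ⟨ξ, x⟩ hq
    simp only [Finset.mem_sigma, Finset.mem_filter] at hq
    obtain ⟨hξ, hx, hxξ⟩ := hq
    have hξ0 : ξ ≠ 0 := fun h => hD0 (h ▸ hξ)
    have hx0 := ne_zero_of_mem hG hx
    have hsub : 1 - -x / ξ = (x + ξ) * ξ⁻¹ := by field_simp; ring
    simp only [powerPairs, Finset.mem_filter, Finset.mem_univ, true_and]
    refine ⟨div_ne_zero (neg_ne_zero.2 hx0) hξ0, ?_, ?_⟩
    · intro h
      have h0 : (x + ξ) * ξ⁻¹ = 0 := by rw [← hsub, h, sub_self]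
      exact mul_ne_zero (ne_zero_of_mem hG hxξ) (inv_ne_zero hξ0) h0
    · rw [hsub, mul_pow, (hG _).1 hxξ, one_mul, show -x / ξ = x * -ξ⁻¹ by field_simp, mul_pow,
        (hG _).1 hx, one_mul]
      exact hD ξ hξ
  · intro y hy
    simp only [powerPairs, Finset.mem_filter, Finset.mem_univ, true_and] at hy
    refine Finset.card_le_card_of_injOn (fun q => q.2) ?_ ?_
    · rintro ⟨ξ, x⟩ hq
      simp only [Finset.coe_filter, Finset.mem_sigma, Finset.mem_filter, Set.mem_ofPred_eq] at hq
      exact hq.1.2.1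
    · rintro ⟨ξ, x⟩ hq ⟨ξ', x'⟩ hq' hxx
      simp only [Finset.coe_filter, Finset.mem_sigma, Finset.mem_filter, Set.mem_ofPred_eq]
        at hq hq' hxx
      subst hxx
      have hξ0 : ξ ≠ 0 := fun h => hD0 (h ▸ hq.1.1)
      have hξ0' : ξ' ≠ 0 := fun h => hD0 (h ▸ hq'.1.1)
      have h := hq.2.trans hq'.2.symm
      rw [div_eq_div_iff hξ0 hξ0'] at h
      have := mul_left_cancel₀ (neg_ne_zero.2 (ne_zero_of_mem hG hq.1.2.1)) h
      rw [this]

/-- `cosetPair` is constant on cosets of `G`, so each value taken on `D` is taken at least `|G|`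
times. -/
theorem card_mul_card_le_of_cosets (hG : ∀ x, x ∈ G ↔ x ^ G.card = 1) {D : Finset (ZMod p)}
    (hD0 : 0 ∉ D) (hD : ∀ γ ∈ G, ∀ ξ ∈ D, γ * ξ ∈ D) {P : Finset (ZMod p × ZMod p)}
    (hP : P ⊆ D.image (cosetPair G.card)) :
    P.card * G.card ≤ {ξ ∈ D | cosetPair G.card ξ ∈ P}.card := by
  have hmaps : ∀ ξ ∈ ({ξ ∈ D | cosetPair G.card ξ ∈ P} : Finset (ZMod p)),
      cosetPair G.card ξ ∈ P := fun ξ hξ => (Finset.mem_filter.1 hξ).2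
  rw [Finset.card_eq_sum_card_fiberwise hmaps, ← smul_eq_mul, ← Finset.sum_const]
  refine Finset.sum_le_sum fun b hb => ?_
  obtain ⟨ξ, hξ, rfl⟩ := Finset.mem_image.1 (hP hb)
  have hξ0 : ξ ≠ 0 := fun h => hD0 (h ▸ hξ)
  refine Finset.card_le_card_of_injOn (fun γ => γ * ξ) ?_
    fun x _ y _ h => mul_left_injective₀ hξ0 h
  intro γ hγ
  rw [Finset.mem_coe] at hγ
  have hpair : cosetPair G.card (γ * ξ) = cosetPair G.card ξ := by
    have h1 : (γ⁻¹) ^ G.card = 1 := by rw [inv_pow, (hG γ).1 hγ, inv_one]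
    rw [cosetPair, cosetPair, mul_inv, neg_mul_eq_mul_neg, mul_pow, mul_pow, h1, one_mul, one_mul]
  simp only [Finset.coe_filter, Set.mem_ofPred_eq, Finset.mem_filter, hpair]
  exact ⟨⟨hD γ hγ ξ hξ, hb⟩, trivial⟩

theorem diffCount_le_of_ne_zero (hG : ∀ x, x ∈ G ↔ x ^ G.card = 1) {M : ℝ}
    (hM : ∀ ξ ≠ 0, ‖dft G ξ‖ ≤ M) (hM0 : 0 ≤ M) {x : ZMod p} (hx : x ≠ 0) :
    (diffCount G x : ℝ) ≤ (G.card : ℝ) ^ 2 / p + M := by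
  have ht : (0 : ℝ) < G.card := Nat.cast_pos.2 (card_pos_of_mem_iff hG)
  have h := card_mul_abs_dev_le hG (mul_mem_of_mem hG) hM hM0 hx
  have h1 := (le_abs_self _).trans (le_of_mul_le_mul_left h ht)
  rw [dev] at h1
  linarith

/-- The set of nonzero `x` with at least `Δ` representations as a difference. -/
noncomputable def popular (G : Finset (ZMod p)) (Δ : ℝ) : Finset (ZMod p) :=
  {x | x ≠ 0 ∧ Δ ≤ diffCount G x}

/-- The weak-type estimate for popular differences of a subgroup. -/
theorem sq_mul_sum_popular_le (hG : ∀ x, x ∈ G ↔ x ^ G.card = 1) {κ K : ℝ}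
    (hp : (p : ℝ) ≤ κ * (G.card : ℝ) ^ 2) (hK5 : 6 ≤ K)
    (hK : 32 * (32000 + 256 * κ ^ 3) < K) {Δ : ℝ}
    (hΔ : K * ((G.card : ℝ) ^ 2 / p) ≤ Δ) :
    Δ ^ 2 * ∑ x ∈ popular G Δ, (diffCount G x : ℝ) ≤ K * (G.card : ℝ) ^ 3 := by
  classical
  have hp0 := natCast_pos_of_prime (p := p)
  have htn := card_pos_of_mem_iff hG
  have ht : (0 : ℝ) < G.card := Nat.cast_pos.2 htn
  set t := G.card with htdef
  set a : ℝ := (t : ℝ) ^ 2 / p with ha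
  have ha0 : 0 < a := by positivity
  have hκ : 0 < κ := pos_of_mul_pos_left (hp0.trans_le hp) (by positivity)
  set C₀ : ℝ := 32000 + 256 * κ ^ 3 with hC₀
  have hC₀1 : 1 ≤ C₀ := by
    have : 0 < κ ^ 3 := by positivity
    rw [hC₀]; linarith
  have hΔ0 : 0 < Δ := lt_of_lt_of_le (by positivity) hΔ
  set D := popular G Δ with hDdef
  have hD0 : (0 : ZMod p) ∉ D := by simp [hDdef, popular]
  have hDmem : ∀ x ∈ D, Δ ≤ (diffCount G x : ℝ) := fun x hx => (Finset.mem_filter.1 hx).2.2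
  have hDinv : ∀ γ ∈ G, ∀ ξ ∈ D, γ * ξ ∈ D := by
    intro γ hγ ξ hξ
    simp only [hDdef, popular, Finset.mem_filter, Finset.mem_univ, true_and] at hξ ⊢
    rw [diffCount_mul hG hγ]
    exact ⟨mul_ne_zero (ne_zero_of_mem hG hγ) hξ.1, hξ.2⟩
  rcases D.eq_empty_or_nonempty with hDe | hDne
  · rw [hDe, Finset.sum_empty, mul_zero]; positivity
  by_cases hsmall : 16 * t ^ 4 ≤ p ^ 3
  swap
  -- Here `√p ≤ 4a`, so every nonzero `x` has at most `5a` representations, which is below `6a ≤ Δ`: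
  -- nothing is popular.
  · exfalso
    obtain ⟨x, hx⟩ := hDne
    have h1 := diffCount_le_of_ne_zero hG (M := √p)
      (fun ξ hξ => Real.le_sqrt_of_sq_le (norm_dft_sq_le hG hξ)) (Real.sqrt_nonneg _)
      (x := x) (fun h => hD0 (h ▸ hx))
    have h2 := hDmem x hx
    have h3 : (p : ℝ) ^ 3 < 16 * (t : ℝ) ^ 4 := by exact_mod_cast not_le.1 hsmall
    have h4 : √(p : ℝ) ≤ 4 * a := by
      rw [Real.sqrt_le_left (by positivity), ha, mul_pow, div_pow, ← mul_div_assoc,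
        le_div_iff₀ (by positivity)]
      calc (p : ℝ) * (p : ℝ) ^ 2 = (p : ℝ) ^ 3 := by ring
        _ ≤ 16 * (t : ℝ) ^ 4 := h3.le
        _ = _ := by ring
    have : (6 : ℝ) * a ≤ K * a := mul_le_mul_of_nonneg_right hK5 ha0.le
    linarith
  set P := D.image (cosetPair t) with hPdef
  have hPne : P.Nonempty := hDne.image _
  -- the bound for a family of cosets on which the multiplicity is large
  have hfam : ∀ P₀ ⊆ P, P₀.Nonempty → 16 * P₀.card * t ^ 4 ≤ p ^ 3 →
      Δ ^ 3 * P₀.card ≤ C₀ * (t : ℝ) ^ 2 := by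
    intro P₀ hP₀ hne hle
    have hk : (0 : ℝ) < P₀.card := Nat.cast_pos.2 hne.card_pos
    have h1 := card_mul_card_le_of_cosets hG hD0 hDinv hP₀
    have h2 := sum_diffCount_le_card_mul hG (D := {ξ ∈ D | cosetPair G.card ξ ∈ P₀})
      (fun h => hD0 (Finset.mem_filter.1 h).1) (fun ξ hξ => (Finset.mem_filter.1 hξ).2)
    have h3 : (({ξ ∈ D | cosetPair G.card ξ ∈ P₀} : Finset (ZMod p)).card : ℝ) * Δ
        ≤ ∑ ξ ∈ D with cosetPair G.card ξ ∈ P₀, (diffCount G ξ : ℝ) := by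
      rw [← nsmul_eq_mul]
      exact Finset.card_nsmul_le_sum _ _ _ fun ξ hξ => hDmem ξ (Finset.mem_filter.1 hξ).1
    have h4 : ((P₀.card : ℝ) * t) * Δ ≤ t * (powerPairs t P₀).card := by
      refine le_trans ?_ (h3.trans (by exact_mod_cast h2))
      exact mul_le_mul_of_nonneg_right (by exact_mod_cast h1) hΔ0.le
    have h5 : (P₀.card : ℝ) * Δ ≤ (powerPairs t P₀).card := by
      refine le_of_mul_le_mul_left ?_ ht
      linarith
    have h6 := (pow_le_pow_left₀ (by positivity) h5 3).trans
      (powerPairs_card_cube_le htn hp hne hle)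
    refine le_of_mul_le_mul_left ?_ (pow_pos hk 2)
    linarith
  by_cases hfull : 16 * P.card * t ^ 4 ≤ p ^ 3
  -- Combine `Δ³|P| ≤ C₀t²` with Stepanov's `Y³ ≤ C₀(|P|t)²` to get `Δ²Y ≤ C₀t²`.
  · have hk : (0 : ℝ) < P.card := Nat.cast_pos.2 hPne.card_pos
    have h1 := hfam P subset_rfl hPne hfull
    have h2 := powerPairs_card_cube_le htn hp hPne hfull
    have h3 := sum_diffCount_le_card_mul hG hD0 (fun ξ hξ => Finset.mem_image_of_mem _ hξ)
    set Y : ℝ := ((powerPairs t P).card : ℝ)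
    have hY : Δ ^ 2 * Y ≤ C₀ * (t : ℝ) ^ 2 := by
      refine (pow_le_pow_iff_left₀ (by positivity) (by positivity) (three_ne_zero)).1 ?_
      calc (Δ ^ 2 * Y) ^ 3 = (Δ ^ 3) ^ 2 * Y ^ 3 := by ring
        _ ≤ (Δ ^ 3) ^ 2 * (C₀ * ((P.card : ℝ) * t) ^ 2) :=
            mul_le_mul_of_nonneg_left h2 (by positivity)
        _ = C₀ * (t : ℝ) ^ 2 * (Δ ^ 3 * P.card) ^ 2 := by ring
        _ ≤ C₀ * (t : ℝ) ^ 2 * (C₀ * (t : ℝ) ^ 2) ^ 2 :=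
            mul_le_mul_of_nonneg_left (pow_le_pow_left₀ (by positivity) h1 2) (by positivity)
        _ = (C₀ * (t : ℝ) ^ 2) ^ 3 := by ring
    calc Δ ^ 2 * ∑ x ∈ D, (diffCount G x : ℝ) ≤ Δ ^ 2 * (t * Y) := by
          refine mul_le_mul_of_nonneg_left ?_ (by positivity)
          simp only [Y]
          exact_mod_cast h3
      _ = t * (Δ ^ 2 * Y) := by ring
      _ ≤ t * (C₀ * (t : ℝ) ^ 2) := mul_le_mul_of_nonneg_left hY ht.le
      _ = C₀ * (t : ℝ) ^ 3 := by ring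
      _ ≤ K * (t : ℝ) ^ 3 := mul_le_mul_of_nonneg_right (by linarith) (by positivity)
  -- If there are too many cosets for Stepanov, apply `hfam` to the largest admissible number `k₀`,
  -- which is comparable to `p³/t⁴`. It forces `K³ ≤ 32C₀`, against the choice of `K`.
  · exfalso
    set k₀ := p ^ 3 / (16 * t ^ 4) with hk₀
    have hden : 0 < 16 * t ^ 4 := by positivity
    have hk₀pos : 0 < k₀ := Nat.div_pos hsmall hden
    have hk₀le : k₀ * (16 * t ^ 4) ≤ p ^ 3 := Nat.div_mul_le_self _ _
    have hk₀P : k₀ ≤ P.card := by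
      by_contra! hlt
      apply hfull
      calc 16 * P.card * t ^ 4 = P.card * (16 * t ^ 4) := by ring
        _ ≤ k₀ * (16 * t ^ 4) := Nat.mul_le_mul_right _ hlt.le
        _ ≤ p ^ 3 := hk₀le
    obtain ⟨P₀, hP₀, hcard⟩ := Finset.exists_subset_card_eq hk₀P
    have h1 := hfam P₀ hP₀ (Finset.card_pos.1 (hcard ▸ hk₀pos)) (by
      rw [hcard]; calc 16 * k₀ * t ^ 4 = k₀ * (16 * t ^ 4) := by ring
        _ ≤ p ^ 3 := hk₀le)
    rw [hcard] at h1
    have h2 : p ^ 3 ≤ k₀ * (32 * t ^ 4) := by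
      have h3 := Nat.div_add_mod (p ^ 3) (16 * t ^ 4)
      have h4 := Nat.mod_lt (p ^ 3) hden
      rw [← hk₀] at h3
      have h5 : 16 * t ^ 4 * 1 ≤ 16 * t ^ 4 * k₀ := Nat.mul_le_mul_left _ hk₀pos
      linarith
    have h2' : (p : ℝ) ^ 3 ≤ k₀ * (32 * (t : ℝ) ^ 4) := by exact_mod_cast h2
    have hKa : (K * a) ^ 3 ≤ Δ ^ 3 := pow_le_pow_left₀ (by positivity) hΔ 3
    have h6 : (K * a) ^ 3 * (p : ℝ) ^ 3 ≤ 32 * C₀ * (t : ℝ) ^ 6 := by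
      calc (K * a) ^ 3 * (p : ℝ) ^ 3 ≤ Δ ^ 3 * (k₀ * (32 * (t : ℝ) ^ 4)) := by gcongr
        _ = 32 * (t : ℝ) ^ 4 * (Δ ^ 3 * k₀) := by ring
        _ ≤ 32 * (t : ℝ) ^ 4 * (C₀ * (t : ℝ) ^ 2) :=
            mul_le_mul_of_nonneg_left h1 (by positivity)
        _ = _ := by ring
    have h7 : (K * a) ^ 3 * (p : ℝ) ^ 3 = K ^ 3 * (t : ℝ) ^ 6 := by
      rw [ha]; field_simp
    rw [h7] at h6
    have h8 := le_of_mul_le_mul_right h6 (by positivity)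
    have h9 : K ≤ K ^ 3 := le_self_pow₀ (by linarith) (by norm_num)
    linarith

/-- The number of solutions of a linear relation in a subgroup of size at most `p ^ (3/4)`. -/
theorem relationCount_cube_le (hG : ∀ x, x ∈ G ↔ x ^ G.card = 1) {κ : ℝ}
    (hp : (p : ℝ) ≤ κ * (G.card : ℝ) ^ 2) (hsmall : 16 * G.card ^ 4 ≤ p ^ 3) {ξ η ζ : ZMod p}
    (hξ : ξ ≠ 0) (hη : η ≠ 0) (hζ : ζ ≠ 0) :
    (relationCount G ξ η ζ : ℝ) ^ 3 ≤ (32000 + 256 * κ ^ 3) * (G.card : ℝ) ^ 5 := by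
  classical
  -- Dividing the relation by `-γζ` gives `y + y' = 1` with `y ∈ (-ξ/ζ)G` and `y' ∈ (-η/ζ)G`, so a
  -- single pair of powers is prescribed. Each `y` arises at most `|G|` times, since `γ` then fixes
  -- `α` and `β`.
  set P : Finset (ZMod p × ZMod p) := {((-ξ / ζ) ^ G.card, (-η / ζ) ^ G.card)} with hP
  have hcard : relationCount G ξ η ζ ≤ G.card * (powerPairs G.card P).card := by
    refine Finset.card_le_mul_card_image_of_maps_to
      (f := fun q => (q.1 / q.2.2) * (-ξ / ζ)) ?_ _ ?_
    · rintro ⟨α, β, γ⟩ hq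
      simp only [Finset.mem_filter, Finset.mem_product] at hq
      obtain ⟨⟨hα, hβ, hγ⟩, hrel⟩ := hq
      have hα0 := ne_zero_of_mem hG hα
      have hβ0 := ne_zero_of_mem hG hβ
      have hγ0 := ne_zero_of_mem hG hγ
      have hsub : 1 - α / γ * (-ξ / ζ) = β / γ * (-η / ζ) := by
        field_simp
        linear_combination hrel
      have hβη : β / γ * (-η / ζ) ≠ 0 :=
        mul_ne_zero (div_ne_zero hβ0 hγ0) (div_ne_zero (neg_ne_zero.2 hη) hζ)
      simp only [powerPairs, Finset.mem_filter, Finset.mem_univ, true_and]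
      refine ⟨mul_ne_zero (div_ne_zero hα0 hγ0) (div_ne_zero (neg_ne_zero.2 hξ) hζ), ?_, ?_⟩
      · intro h
        rw [h, sub_self] at hsub
        exact hβη hsub.symm
      · rw [hsub, mul_pow, mul_pow, (hG _).1 (div_mem_of_mem hG γ hγ α hα),
          (hG _).1 (div_mem_of_mem hG γ hγ β hβ), one_mul, one_mul, hP]
        exact Finset.mem_singleton_self _
    · intro y _
      refine Finset.card_le_card_of_injOn (fun q => q.2.2) ?_ ?_
      · rintro ⟨α, β, γ⟩ hq
        simp only [Finset.coe_filter, Finset.mem_filter, Finset.mem_product,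
          Set.mem_ofPred_eq] at hq
        exact hq.1.1.2.2
      · rintro ⟨α, β, γ⟩ hq ⟨α', β', γ'⟩ hq' hγγ
        simp only [Finset.coe_filter, Finset.mem_filter, Finset.mem_product,
          Set.mem_ofPred_eq] at hq hq' hγγ
        subst hγγ
        have hγ0 := ne_zero_of_mem hG hq.1.1.2.2
        have h := hq.2.trans hq'.2.symm
        have h1 := mul_right_cancel₀ (div_ne_zero (neg_ne_zero.2 hξ) hζ) h
        have hα : α = α' := (div_left_inj' hγ0).1 h1
        subst hα
        have hβ : β = β' := by
          have h2 := hq.1.2.trans hq'.1.2.symm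
          exact mul_right_cancel₀ hη (by linear_combination h2)
        rw [hβ]
  have h1 := powerPairs_card_cube_le (card_pos_of_mem_iff hG) hp (P := P)
    (Finset.singleton_nonempty _) (by simpa [hP] using hsmall)
  have hPc : (P.card : ℝ) = 1 := by simp [hP]
  rw [hPc, one_mul] at h1
  calc (relationCount G ξ η ζ : ℝ) ^ 3 ≤ (G.card * (powerPairs G.card P).card : ℝ) ^ 3 :=
        pow_le_pow_left₀ (Nat.cast_nonneg _) (by exact_mod_cast hcard) 3
    _ = (G.card : ℝ) ^ 3 * ((powerPairs G.card P).card : ℝ) ^ 3 := by ring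
    _ ≤ (G.card : ℝ) ^ 3 * ((32000 + 256 * κ ^ 3) * (G.card : ℝ) ^ 2) :=
        mul_le_mul_of_nonneg_left h1 (by positivity)
    _ = _ := by ring

end WeakType

/-! ### Expansion of the energy around averages, and moment bounds. -/

section Energy

variable {p : ℕ} [Fact p.Prime] {G S : Finset (ZMod p)}

theorem sum_diffCount_mul_sq_sub (A B : Finset (ZMod p)) :
    ∑ x, (diffCount A x : ℝ) * (diffCount B x : ℝ) ^ 2
        - (A.card : ℝ) ^ 2 * (B.card : ℝ) ^ 4 / (p : ℝ) ^ 2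
      = ∑ x, dev A x * dev B x ^ 2 + 2 * ((B.card : ℝ) ^ 2 / p) * ∑ x, dev A x * dev B x
        + (A.card : ℝ) ^ 2 / p * ∑ x, dev B x * dev B x := by
  have hp := (natCast_pos_of_prime (p := p)).ne'
  set a : ℝ := (A.card : ℝ) ^ 2 / p with ha
  set b : ℝ := (B.card : ℝ) ^ 2 / p with hb
  have hA : ∀ x, (diffCount A x : ℝ) = dev A x + a := fun x => by rw [dev]; ring
  have hB : ∀ x, (diffCount B x : ℝ) = dev B x + b := fun x => by rw [dev]; ring
  have h1 : ∀ x, (diffCount A x : ℝ) * (diffCount B x : ℝ) ^ 2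
      = dev A x * dev B x ^ 2 + 2 * b * (dev A x * dev B x) + a * (dev B x * dev B x)
        + b ^ 2 * dev A x + 2 * a * b * dev B x + a * b ^ 2 := by
    intro x; rw [hA, hB]; ring
  simp only [h1, Finset.sum_add_distrib, ← Finset.mul_sum, sum_dev, Finset.sum_const,
    Finset.card_univ, ZMod.card, nsmul_eq_mul]
  have h2 : a * ((p : ℝ) * b ^ 2) = (A.card : ℝ) ^ 2 * (B.card : ℝ) ^ 4 / (p : ℝ) ^ 2 := by
    rw [ha, hb]; field_simp
  linear_combination h2

theorem card_mul_sum_dev_sq_le (hG : ∀ x, x ∈ G ↔ x ^ G.card = 1)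
    (hS : ∀ γ ∈ G, ∀ x ∈ S, γ * x ∈ S) :
    G.card * ∑ x, dev S x * dev S x ≤ p * (S.card : ℝ) ^ 2 := by
  have ht : (0 : ℝ) < G.card := Nat.cast_pos.2 (card_pos_of_mem_iff hG)
  have h := sum_dev_sq_le (w := p * S.card / G.card) S S (fun ξ hξ => by
    rw [mul_div_assoc]
    refine mul_le_mul_of_nonneg_left ?_ natCast_pos_of_prime.le
    rw [le_div_iff₀ ht, mul_comm]
    exact card_mul_spec_le hG hS hξ)
  calc G.card * ∑ x, dev S x * dev S x ≤ G.card * (p * S.card / G.card * S.card) :=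
        mul_le_mul_of_nonneg_left h ht.le
    _ = p * (S.card : ℝ) ^ 2 := by field_simp

variable {M : ℝ}

theorem sum_dev_mul_dev_le (hM : ∀ ξ ≠ 0, ‖dft G ξ‖ ≤ M) :
    ∑ x, dev G x * dev S x ≤ M ^ 2 * S.card := by
  refine sum_dev_sq_le G S fun ξ hξ => ?_
  rw [spec, mul_div_cancel₀ _ natCast_pos_of_prime.ne']
  exact pow_le_pow_left₀ (norm_nonneg _) (hM ξ hξ) 2

/-- A bound for the same second moment in terms of `M` instead of the orbit argument; this is the
source of the term `|S|³M²/p`. -/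
theorem card_sq_mul_sum_dev_sq_le (hG : ∀ x, x ∈ G ↔ x ^ G.card = 1)
    (hS : ∀ γ ∈ G, ∀ x ∈ S, γ * x ∈ S) (hS0 : 0 ∉ S) (hM : ∀ ξ ≠ 0, ‖dft G ξ‖ ≤ M) :
    (G.card : ℝ) ^ 2 * ∑ x, dev S x * dev S x ≤ (S.card : ℝ) ^ 3 * M ^ 2 := by
  have ht : (0 : ℝ) < G.card := Nat.cast_pos.2 (card_pos_of_mem_iff hG)
  have h := sum_dev_sq_le (w := (S.card * M / G.card) ^ 2) S S (fun ξ hξ => by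
    rw [spec, mul_div_cancel₀ _ natCast_pos_of_prime.ne']
    refine pow_le_pow_left₀ (norm_nonneg _) ?_ 2
    rw [le_div_iff₀ ht, mul_comm]
    exact card_mul_norm_dft_le hG hS hS0 hM hξ)
  calc (G.card : ℝ) ^ 2 * ∑ x, dev S x * dev S x
      ≤ (G.card : ℝ) ^ 2 * ((S.card * M / G.card) ^ 2 * S.card) :=
        mul_le_mul_of_nonneg_left h (by positivity)
    _ = (S.card : ℝ) ^ 3 * M ^ 2 := by field_simp

/-- Dyadic decomposition: the layer between `Δ` and `2Δ` contributes at most `4T`, and no layer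
remains once the level exceeds `|G|`. -/
theorem sum_popular_cube_le {Δ₀ T : ℝ}
    (hweak : ∀ Δ, Δ₀ ≤ Δ → Δ ^ 2 * ∑ x ∈ popular G Δ, (diffCount G x : ℝ) ≤ T) (n : ℕ) {Δ : ℝ}
    (hΔ : Δ₀ ≤ Δ) (hpos : 0 < Δ) (hn : G.card < Δ * 2 ^ n) :
    ∑ x ∈ popular G Δ, (diffCount G x : ℝ) ^ 3 ≤ n * (4 * T) := by
  classical
  induction n generalizing Δ with
  | zero =>
    have : popular G Δ = ∅ := by
      refine Finset.filter_eq_empty_iff.2 fun x _ h => ?_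
      have h1 : (diffCount G x : ℝ) ≤ G.card := Nat.cast_le.2 (diffCount_le_card G x)
      rw [pow_zero, mul_one] at hn
      linarith [h.2]
    simp [this]
  | succ n ih =>
    have h1 := ih (Δ := 2 * Δ) (by linarith) (by linarith) (by rw [pow_succ] at hn; linarith)
    have h2 : ∀ x ∈ popular G Δ, (diffCount G x : ℝ) ^ 3
        ≤ 4 * Δ ^ 2 * diffCount G x
          + if 2 * Δ ≤ diffCount G x then (diffCount G x : ℝ) ^ 3 else 0 := by
      intro x hx
      have h0 : (0 : ℝ) ≤ diffCount G x := Nat.cast_nonneg _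
      split_ifs with h
      · have : 0 ≤ 4 * Δ ^ 2 * (diffCount G x : ℝ) := by positivity
        linarith
      · have h3 : (diffCount G x : ℝ) ^ 2 ≤ (2 * Δ) ^ 2 := pow_le_pow_left₀ h0 (not_le.1 h).le 2
        calc (diffCount G x : ℝ) ^ 3 = (diffCount G x : ℝ) ^ 2 * diffCount G x := by ring
          _ ≤ (2 * Δ) ^ 2 * diffCount G x := mul_le_mul_of_nonneg_right h3 h0
          _ = _ := by ring
    have h4 : ({x ∈ popular G Δ | 2 * Δ ≤ diffCount G x} : Finset (ZMod p))
        ⊆ popular G (2 * Δ) := by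
      intro x hx
      simp only [popular, Finset.mem_filter, Finset.mem_univ, true_and] at hx ⊢
      exact ⟨hx.1.1, hx.2⟩
    have h5 := hweak Δ hΔ
    calc ∑ x ∈ popular G Δ, (diffCount G x : ℝ) ^ 3
        ≤ 4 * (Δ ^ 2 * ∑ x ∈ popular G Δ, (diffCount G x : ℝ))
          + ∑ x ∈ popular G Δ with 2 * Δ ≤ diffCount G x, (diffCount G x : ℝ) ^ 3 := by
          refine (Finset.sum_le_sum h2).trans_eq ?_
          rw [Finset.sum_add_distrib, ← Finset.mul_sum, Finset.sum_filter, mul_assoc]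
      _ ≤ 4 * T + ∑ x ∈ popular G (2 * Δ), (diffCount G x : ℝ) ^ 3 :=
          add_le_add (by linarith) (Finset.sum_le_sum_of_subset_of_nonneg h4
            fun _ _ _ => by positivity)
      _ ≤ ((n + 1 : ℕ) : ℝ) * (4 * T) := by push_cast; linarith

theorem dev_nonneg_of_le {x : ZMod p} (h : (G.card : ℝ) ^ 2 / p ≤ diffCount G x) :
    0 ≤ dev G x := by
  rw [dev]; linarith

theorem abs_dev_le_of_lt {Δ : ℝ} (hΔ : (G.card : ℝ) ^ 2 / p ≤ Δ) {x : ZMod p}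
    (h : (diffCount G x : ℝ) < Δ) : |dev G x| ≤ Δ := by
  rw [abs_le]
  have h1 := neg_le_dev G x
  have h2 := dev_le_diffCount G x
  constructor <;> linarith

/-- Split into `x = 0`, popular `x` and the rest. As `Δ` is at least the average, deviations are
nonnegative at popular `x` and at most `Δ` in absolute value elsewhere. -/
theorem abs_sum_dev_subgroup_cube_le {Δ : ℝ} (hΔ : (G.card : ℝ) ^ 2 / p ≤ Δ) :
    |∑ x, dev G x ^ 3| ≤ (G.card : ℝ) ^ 3 + Δ * ∑ x, dev G x * dev G x
      + ∑ x ∈ popular G Δ, (diffCount G x : ℝ) ^ 3 := by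
  classical
  have hΔ0 : 0 ≤ Δ := le_trans (by positivity) hΔ
  have hpt : ∀ x, |dev G x ^ 3| ≤ (if x = 0 then (G.card : ℝ) ^ 3 else 0)
      + Δ * (dev G x * dev G x)
      + if x ≠ 0 ∧ Δ ≤ diffCount G x then (diffCount G x : ℝ) ^ 3 else 0 := by
    intro x
    have h0 : 0 ≤ Δ * (dev G x * dev G x) := mul_nonneg hΔ0 (mul_self_nonneg _)
    rw [abs_pow]
    by_cases hx : x = 0
    · subst hx
      have := pow_le_pow_left₀ (dev_zero_nonneg G) (dev_zero_le G) 3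
      rw [abs_of_nonneg (dev_zero_nonneg G)]
      simp only [if_true, ne_eq, not_true_eq_false, false_and, if_false]
      linarith
    · by_cases hr : Δ ≤ diffCount G x
      · have h1 := dev_nonneg_of_le (hΔ.trans hr)
        have := pow_le_pow_left₀ h1 (dev_le_diffCount G x) 3
        rw [abs_of_nonneg h1]
        simp only [hx, hr, if_false, ne_eq, not_false_eq_true, true_and, if_true]
        linarith
      · have h1 := abs_dev_le_of_lt hΔ (not_le.1 hr)
        simp only [hx, hr, if_false, and_false]
        calc |dev G x| ^ 3 = |dev G x| * (|dev G x| * |dev G x|) := by ring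
          _ = |dev G x| * (dev G x * dev G x) := by rw [abs_mul_abs_self]
          _ ≤ Δ * (dev G x * dev G x) := mul_le_mul_of_nonneg_right h1 (mul_self_nonneg _)
          _ = _ := by ring
  calc |∑ x, dev G x ^ 3| ≤ ∑ x, |dev G x ^ 3| := Finset.abs_sum_le_sum_abs _ _
    _ ≤ _ := Finset.sum_le_sum fun x _ => hpt x
    _ = _ := by
      rw [Finset.sum_add_distrib, Finset.sum_add_distrib, Finset.sum_ite_eq' Finset.univ,
        if_pos (Finset.mem_univ _), ← Finset.mul_sum, popular, Finset.sum_filter]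

theorem abs_sum_dev_mul_sq_le {Δ H : ℝ} (hΔ : (G.card : ℝ) ^ 2 / p ≤ Δ)
    (hH : ∀ x ≠ 0, |dev S x| ≤ H) :
    |∑ x, dev G x * dev S x ^ 2| ≤ G.card * (S.card : ℝ) ^ 2 + Δ * ∑ x, dev S x * dev S x
      + H ^ 2 * ∑ x ∈ popular G Δ, (diffCount G x : ℝ) := by
  classical
  have hΔ0 : 0 ≤ Δ := le_trans (by positivity) hΔ
  have hpt : ∀ x, |dev G x * dev S x ^ 2| ≤ (if x = 0 then G.card * (S.card : ℝ) ^ 2 else 0)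
      + Δ * (dev S x * dev S x)
      + if x ≠ 0 ∧ Δ ≤ diffCount G x then (H ^ 2 * diffCount G x : ℝ) else 0 := by
    intro x
    have h0 : 0 ≤ Δ * (dev S x * dev S x) := mul_nonneg hΔ0 (mul_self_nonneg _)
    rw [abs_mul, abs_pow]
    by_cases hx : x = 0
    · subst hx
      have := pow_le_pow_left₀ (dev_zero_nonneg S) (dev_zero_le S) 2
      have h2 : dev G 0 * dev S 0 ^ 2 ≤ G.card * (S.card : ℝ) ^ 2 :=
        mul_le_mul (dev_zero_le G) this (by positivity) (Nat.cast_nonneg _)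
      rw [abs_of_nonneg (dev_zero_nonneg G), abs_of_nonneg (dev_zero_nonneg S)]
      simp only [if_true, ne_eq, not_true_eq_false, false_and, if_false]
      linarith
    · by_cases hr : Δ ≤ diffCount G x
      · have h1 := dev_nonneg_of_le (hΔ.trans hr)
        have h2 : dev G x * |dev S x| ^ 2 ≤ diffCount G x * H ^ 2 :=
          mul_le_mul (dev_le_diffCount G x) (pow_le_pow_left₀ (abs_nonneg _) (hH x hx) 2)
            (by positivity) (Nat.cast_nonneg _)
        rw [abs_of_nonneg h1]
        simp only [hx, hr, if_false, ne_eq, not_false_eq_true, true_and, if_true]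
        linarith
      · have h1 := abs_dev_le_of_lt hΔ (not_le.1 hr)
        simp only [hx, hr, if_false, and_false]
        rw [sq_abs]
        have h2 := mul_le_mul_of_nonneg_right h1 (sq_nonneg (dev S x))
        linarith
  calc |∑ x, dev G x * dev S x ^ 2| ≤ ∑ x, |dev G x * dev S x ^ 2| :=
        Finset.abs_sum_le_sum_abs _ _
    _ ≤ _ := Finset.sum_le_sum fun x _ => hpt x
    _ = _ := by
      rw [Finset.sum_add_distrib, Finset.sum_add_distrib, Finset.sum_ite_eq' Finset.univ,
        if_pos (Finset.mem_univ _), popular, Finset.mul_sum, Finset.mul_sum, Finset.sum_filter]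

theorem abs_sum_dev_cube_le_of_sup {H : ℝ} (hH0 : 0 ≤ H) (hH : ∀ x ≠ 0, |dev S x| ≤ H) :
    |∑ x, dev S x ^ 3| ≤ (S.card : ℝ) ^ 3 + H * ∑ x, dev S x * dev S x := by
  classical
  have hpt : ∀ x, |dev S x ^ 3| ≤ (if x = 0 then (S.card : ℝ) ^ 3 else 0)
      + H * (dev S x * dev S x) := by
    intro x
    rw [abs_pow]
    by_cases hx : x = 0
    · subst hx
      have := pow_le_pow_left₀ (dev_zero_nonneg S) (dev_zero_le S) 3
      rw [abs_of_nonneg (dev_zero_nonneg S), if_pos rfl]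
      have h0 : 0 ≤ H * (dev S 0 * dev S 0) := mul_nonneg hH0 (mul_self_nonneg _)
      linarith
    · rw [if_neg hx, zero_add]
      calc |dev S x| ^ 3 = |dev S x| * (|dev S x| * |dev S x|) := by ring
        _ = |dev S x| * (dev S x * dev S x) := by rw [abs_mul_abs_self]
        _ ≤ H * (dev S x * dev S x) := mul_le_mul_of_nonneg_right (hH x hx) (mul_self_nonneg _)
  calc |∑ x, dev S x ^ 3| ≤ ∑ x, |dev S x ^ 3| := Finset.abs_sum_le_sum_abs _ _
    _ ≤ _ := Finset.sum_le_sum fun x _ => hpt x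
    _ = _ := by
      rw [Finset.sum_add_distrib, Finset.sum_ite_eq' Finset.univ, if_pos (Finset.mem_univ _),
        ← Finset.mul_sum]

end Energy

/-! ### The three energy estimates, in terms of cube roots. -/

section Bounds

variable {p : ℕ} [Fact p.Prime] {G S : Finset (ZMod p)} {M κ c K x y z : ℝ}

/-- The third energy of a subgroup; `x, y, z` are the cube roots of `p, M, |G|`. -/
theorem energy_subgroup_bound (hG : ∀ x, x ∈ G ↔ x ^ G.card = 1)
    (hM : ∀ ξ ≠ 0, ‖dft G ξ‖ ≤ M) (hM2 : M ^ 2 ≤ p)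
    (hp : (p : ℝ) ≤ κ * (G.card : ℝ) ^ 2) (hc0 : 0 ≤ c) (hc : (G.card : ℝ) ^ 4 ≤ c * (p : ℝ) ^ 3)
    (hK6 : 6 ≤ K) (hKκ : κ ≤ K) (hK : 32 * (32000 + 256 * κ ^ 3) < K) (ht2 : 2 ≤ G.card)
    (hx : x ^ 3 = p) (hy : y ^ 3 = M) (hz : z ^ 3 = G.card) (hx0 : 0 < x)
    (hz0 : 0 < z) :
    |∑ u, (diffCount G u : ℝ) * (diffCount G u : ℝ) ^ 2
        - (G.card : ℝ) ^ 2 * (G.card : ℝ) ^ 4 / (p : ℝ) ^ 2|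
      ≤ 20 * K * (1 + c) * ((G.card : ℝ) ^ 3 * Real.logb 2 G.card ^ 3
        + x * y ^ 4 * z ^ 5 * Real.logb 2 G.card ^ 3) := by
  have hp0 := natCast_pos_of_prime (p := p)
  have ht : (0 : ℝ) < G.card := Nat.cast_pos.2 (card_pos_of_mem_iff hG)
  set t : ℝ := (G.card : ℝ) with htdef
  set L : ℝ := Real.logb 2 t with hL
  have hL1 : 1 ≤ L := by
    rw [hL, Real.le_logb_iff_rpow_le (by norm_num) ht, Real.rpow_one, htdef]
    exact_mod_cast ht2
  have hL3 : L ≤ L ^ 3 := le_self_pow₀ hL1 (by norm_num)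
  set a : ℝ := t ^ 2 / p with ha
  have ha0 : 0 < a := by positivity
  have hKa : a ≤ K * a := le_mul_of_one_le_left ha0.le (by linarith)
  have h1 := abs_sum_dev_subgroup_cube_le (G := G) (Δ := K * a) hKa
  have hKa1 : 1 ≤ K * a := by
    rw [ha, ← mul_div_assoc, le_div_iff₀ hp0, one_mul]
    exact hp.trans (mul_le_mul_of_nonneg_right hKκ (by positivity))
  have h2 : ∑ u ∈ popular G (K * a), (diffCount G u : ℝ) ^ 3 ≤ 2 * L * (4 * (K * t ^ 3)) := by
    -- The starting level is at least `1`, so about `log |G|` dyadic layers suffice; only the first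
    -- power of the logarithm is incurred.
    have hn : t < K * a * 2 ^ (Nat.log 2 G.card + 1) := by
      have h3 : t < 2 ^ (Nat.log 2 G.card + 1) := by
        rw [htdef]; exact_mod_cast Nat.lt_pow_succ_log_self (by norm_num) G.card
      exact h3.trans_le (le_mul_of_one_le_left (by positivity) hKa1)
    refine (sum_popular_cube_le (T := K * t ^ 3)
      (fun Δ hΔ => sq_mul_sum_popular_le hG hp hK6 hK hΔ) _ le_rfl (by positivity) hn).trans ?_
    refine mul_le_mul_of_nonneg_right ?_ (by positivity)
    have h4 : ((Nat.log 2 G.card : ℕ) : ℝ) ≤ L := by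
      rw [hL, htdef]; exact_mod_cast Real.natLog_le_logb G.card 2
    push_cast; linarith
  set Q := ∑ u, dev G u * dev G u with hQ
  have hQ0 : 0 ≤ Q := sum_dev_mul_dev_nonneg G G
  have hQM : Q ≤ M ^ 2 * t := sum_dev_mul_dev_le hM
  -- From `M² ≤ p` and `t⁴ ≤ cp³`; it lets the second-moment term `t³M²/p` be absorbed into `p^(1/3)
  -- M^(4/3) t^(5/3)`.
  have hyz : y ^ 2 * z ^ 4 ≤ (1 + c) * x ^ 4 := by
    refine (pow_le_pow_iff_left₀ (by positivity) (by positivity) (three_ne_zero)).1 ?_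
    calc (y ^ 2 * z ^ 4) ^ 3 = (y ^ 3) ^ 2 * (z ^ 3) ^ 4 := by ring
      _ ≤ p * (c * p ^ 3) := by
          rw [hy, hz]; exact mul_le_mul hM2 hc (by positivity) hp0.le
      _ = c * (x ^ 4) ^ 3 := by rw [← hx]; ring
      _ ≤ (1 + c) ^ 3 * (x ^ 4) ^ 3 := by
          refine mul_le_mul_of_nonneg_right ?_ (by positivity)
          nlinarith [pow_nonneg hc0 2, pow_nonneg hc0 3]
      _ = _ := by ring
  have haQ : a * Q ≤ (1 + c) * (x * y ^ 4 * z ^ 5) := by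
    calc a * Q ≤ a * (M ^ 2 * t) := mul_le_mul_of_nonneg_left hQM ha0.le
      _ = y ^ 2 * z ^ 4 * (y ^ 4 * z ^ 5) / x ^ 3 := by
          rw [ha, ← hx, ← hy, ← hz]; field_simp
      _ ≤ (1 + c) * x ^ 4 * (y ^ 4 * z ^ 5) / x ^ 3 := by gcongr
      _ = _ := by field_simp
  have h5 := sum_diffCount_mul_sq_sub G G
  have h6 : ∑ u, dev G u * dev G u ^ 2 = ∑ u, dev G u ^ 3 :=
    Finset.sum_congr rfl fun u _ => by ring
  rw [h6, ← htdef, ← ha, ← hQ] at h5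
  rw [h5]
  have hW : 0 ≤ x * y ^ 4 * z ^ 5 := by positivity
  have hWL : x * y ^ 4 * z ^ 5 ≤ x * y ^ 4 * z ^ 5 * L ^ 3 :=
    le_mul_of_one_le_right hW (hL1.trans hL3)
  have hTL : t ^ 3 * L ≤ t ^ 3 * L ^ 3 := mul_le_mul_of_nonneg_left hL3 (by positivity)
  have hT1 : t ^ 3 ≤ t ^ 3 * L ^ 3 := le_mul_of_one_le_right (by positivity) (hL1.trans hL3)
  have hrem : 0 ≤ 2 * a * Q + a * Q := by positivity
  have hKc : K ≤ K * (1 + c) := le_mul_of_one_le_right (by linarith) (by linarith)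
  calc |∑ u, dev G u ^ 3 + 2 * a * Q + a * Q|
      ≤ |∑ u, dev G u ^ 3| + (2 * a * Q + a * Q) := by
        rw [add_assoc]
        exact (abs_add_le _ _).trans_eq (by rw [abs_of_nonneg hrem])
    _ ≤ t ^ 3 + 8 * K * (t ^ 3 * L) + (K + 3) * (a * Q) := by linarith
    _ ≤ t ^ 3 * L ^ 3 + 8 * K * (t ^ 3 * L ^ 3)
        + (K + 3) * ((1 + c) * (x * y ^ 4 * z ^ 5 * L ^ 3)) := by
        have : (1 + c) * (x * y ^ 4 * z ^ 5) ≤ (1 + c) * (x * y ^ 4 * z ^ 5 * L ^ 3) :=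
          mul_le_mul_of_nonneg_left hWL (by linarith)
        have h8 := haQ.trans this
        gcongr
    _ = (1 + 8 * K) * (t ^ 3 * L ^ 3) + (K + 3) * (1 + c) * (x * y ^ 4 * z ^ 5 * L ^ 3) := by ring
    _ ≤ 20 * K * (1 + c) * (t ^ 3 * L ^ 3)
        + 20 * K * (1 + c) * (x * y ^ 4 * z ^ 5 * L ^ 3) := by
        refine add_le_add (mul_le_mul_of_nonneg_right (by linarith) (by positivity))
          (mul_le_mul_of_nonneg_right ?_ (by positivity))
        exact mul_le_mul_of_nonneg_right (by linarith) (by linarith)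
    _ = _ := by ring

theorem energyPair_bound (hG : ∀ x, x ∈ G ↔ x ^ G.card = 1)
    (hS : ∀ γ ∈ G, ∀ x ∈ S, γ * x ∈ S) (hS0 : 0 ∉ S)
    (hM : ∀ ξ ≠ 0, ‖dft G ξ‖ ≤ M)
    (hp : (p : ℝ) ≤ κ * (G.card : ℝ) ^ 2)
    (hK6 : 6 ≤ K) (hK : 32 * (32000 + 256 * κ ^ 3) < K)
    (hx : x ^ 3 = p) (hy : y ^ 3 = M) (hz : z ^ 3 = G.card) (hx0 : 0 < x) (hy0 : 0 ≤ y)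
    (hz0 : 0 < z) :
    |∑ u, (diffCount G u : ℝ) * (diffCount S u : ℝ) ^ 2
        - (G.card : ℝ) ^ 2 * (S.card : ℝ) ^ 4 / (p : ℝ) ^ 2|
      ≤ 20 * K * ((S.card : ℝ) ^ 2 * G.card + (S.card : ℝ) ^ 3 * M ^ 2 / p
        + x ^ 2 * y ^ 2 * (S.card : ℝ) ^ 2 * z⁻¹) := by
  have hp0 := natCast_pos_of_prime (p := p)
  have ht : (0 : ℝ) < G.card := Nat.cast_pos.2 (card_pos_of_mem_iff hG)
  have hM0 : 0 ≤ M := by rw [← hy]; positivity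
  set t : ℝ := (G.card : ℝ) with htdef
  set s : ℝ := (S.card : ℝ) with hsdef
  have hs0 : 0 ≤ s := Nat.cast_nonneg _
  set a : ℝ := t ^ 2 / p with ha
  have ha0 : 0 < a := by positivity
  -- `Δ₀³ = M²t²/p` balances the unpopular part `Δ · ps²/t` against the popular part `(sM/t)² ·
  -- t³/Δ²`. Adding `K * a` makes the weak-type bound applicable.
  set Δ₀ : ℝ := y ^ 2 * z ^ 2 / x with hΔ₀
  have hΔ₀0 : 0 ≤ Δ₀ := by positivity
  have hKa0 : 0 ≤ K * a := by positivity
  have haΔ : a ≤ Δ₀ + K * a := by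
    have : a ≤ K * a := le_mul_of_one_le_left ha0.le (by linarith)
    linarith
  have hsup : ∀ u ≠ 0, |dev S u| ≤ s * M / t := by
    intro u hu
    rw [le_div_iff₀ ht, mul_comm]
    exact card_mul_abs_dev_le hG hS hM hM0 hu
  have h1 := abs_sum_dev_mul_sq_le (G := G) haΔ hsup
  have h2 := sq_mul_sum_popular_le hG hp hK6 hK (Δ := Δ₀ + K * a) (by rw [← ha]; linarith)
  set Q := ∑ u, dev S u * dev S u with hQ
  set R := ∑ u ∈ popular G (Δ₀ + K * a), (diffCount G u : ℝ) with hR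
  have hR0 : 0 ≤ R := Finset.sum_nonneg fun _ _ => Nat.cast_nonneg _
  have hQ0 : 0 ≤ Q := sum_dev_mul_dev_nonneg S S
  have hQ1 : Q ≤ p * s ^ 2 / t := by
    rw [le_div_iff₀ ht, mul_comm]; exact card_mul_sum_dev_sq_le hG hS
  have hQ2 : Q ≤ s ^ 3 * M ^ 2 / t ^ 2 := by
    rw [le_div_iff₀ (by positivity), mul_comm]; exact card_sq_mul_sum_dev_sq_le hG hS hS0 hM
  have haQ : a * Q ≤ s ^ 3 * M ^ 2 / p := by
    calc a * Q ≤ a * (s ^ 3 * M ^ 2 / t ^ 2) := mul_le_mul_of_nonneg_left hQ2 ha0.le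
      _ = _ := by rw [ha]; field_simp
  have hΔQ : Δ₀ * Q ≤ x ^ 2 * y ^ 2 * s ^ 2 * z⁻¹ := by
    calc Δ₀ * Q ≤ Δ₀ * (p * s ^ 2 / t) := mul_le_mul_of_nonneg_left hQ1 hΔ₀0
      _ = _ := by rw [hΔ₀, ← hx, ← hz]; field_simp
  -- The factor `y⁴` stays on the left because `M`, hence `Δ₀`, is not assumed positive.
  have hyR : y ^ 4 * R ≤ K * x ^ 2 * z ^ 5 := by
    have h3 : Δ₀ ^ 2 * R ≤ K * t ^ 3 :=
      (mul_le_mul_of_nonneg_right (pow_le_pow_left₀ hΔ₀0 (by linarith) 2) hR0).trans h2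
    have h4 : Δ₀ ^ 2 * R = y ^ 4 * R * (z ^ 4 / x ^ 2) := by rw [hΔ₀]; field_simp
    have h5 : K * t ^ 3 = K * x ^ 2 * z ^ 5 * (z ^ 4 / x ^ 2) := by
      rw [← hz]; field_simp
    rw [h4, h5] at h3
    exact le_of_mul_le_mul_right h3 (by positivity)
  have hMR : (s * M / t) ^ 2 * R ≤ K * (x ^ 2 * y ^ 2 * s ^ 2 * z⁻¹) := by
    calc (s * M / t) ^ 2 * R = s ^ 2 * y ^ 2 / z ^ 6 * (y ^ 4 * R) := by
          rw [← hy, ← hz]; field_simp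
      _ ≤ s ^ 2 * y ^ 2 / z ^ 6 * (K * x ^ 2 * z ^ 5) :=
          mul_le_mul_of_nonneg_left hyR (by positivity)
      _ = _ := by field_simp
  set V := ∑ u, dev G u * dev S u with hV
  have hV0 : 0 ≤ V := sum_dev_mul_dev_nonneg G S
  have hV1 : V ≤ M ^ 2 * s := sum_dev_mul_dev_le hM
  have hbV : s ^ 2 / p * V ≤ s ^ 3 * M ^ 2 / p := by
    calc s ^ 2 / p * V ≤ s ^ 2 / p * (M ^ 2 * s) :=
          mul_le_mul_of_nonneg_left hV1 (by positivity)
      _ = _ := by ring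
  rw [sum_diffCount_mul_sq_sub G S, ← htdef, ← hsdef, ← ha, ← hQ, ← hV]
  have hrem : 0 ≤ 2 * (s ^ 2 / p) * V + a * Q := by positivity
  set E1 : ℝ := s ^ 2 * t with hE1
  set E2 : ℝ := s ^ 3 * M ^ 2 / p with hE2
  set E3 : ℝ := x ^ 2 * y ^ 2 * s ^ 2 * z⁻¹ with hE3
  have hE1' : 0 ≤ E1 := by positivity
  have hE2' : 0 ≤ E2 := by positivity
  have hE3' : 0 ≤ E3 := by positivity
  calc |∑ u, dev G u * dev S u ^ 2 + 2 * (s ^ 2 / p) * V + a * Q|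
      ≤ |∑ u, dev G u * dev S u ^ 2| + (2 * (s ^ 2 / p) * V + a * Q) := by
        rw [add_assoc]
        exact (abs_add_le _ _).trans_eq (by rw [abs_of_nonneg hrem])
    _ ≤ E1 + (Δ₀ * Q + K * (a * Q)) + (s * M / t) ^ 2 * R + (2 * (s ^ 2 / p * V) + a * Q) := by
        have : t * s ^ 2 = E1 := by rw [hE1]; ring
        linarith
    _ ≤ E1 + (E3 + K * E2) + K * E3 + (2 * E2 + E2) := by gcongr
    _ = 1 * E1 + (K + 3) * E2 + (K + 1) * E3 := by ring
    _ ≤ 20 * K * E1 + 20 * K * E2 + 20 * K * E3 := by gcongr <;> linarith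
    _ = _ := by ring

theorem energy_invariant_bound (hG : ∀ x, x ∈ G ↔ x ^ G.card = 1)
    (hS : ∀ γ ∈ G, ∀ x ∈ S, γ * x ∈ S)
    (hp : (p : ℝ) ≤ κ * (G.card : ℝ) ^ 2) (hc0 : 0 ≤ c) (hc : (G.card : ℝ) ^ 4 ≤ c * (p : ℝ) ^ 3)
    (hK6 : 6 ≤ K) (hK : 32 * (32000 + 256 * κ ^ 3) < K)
    (hz : z ^ 3 = G.card) (hz0 : 0 < z) :
    |∑ u, (diffCount S u : ℝ) * (diffCount S u : ℝ) ^ 2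
        - (S.card : ℝ) ^ 2 * (S.card : ℝ) ^ 4 / (p : ℝ) ^ 2|
      ≤ 20 * K * (1 + c) * ((S.card : ℝ) ^ 4 * (G.card : ℝ)⁻¹
        + p * (S.card : ℝ) ^ 3 * (z ^ 4)⁻¹) := by
  have hp0 := natCast_pos_of_prime (p := p)
  have ht : (0 : ℝ) < G.card := Nat.cast_pos.2 (card_pos_of_mem_iff hG)
  have hκ : 0 < κ := pos_of_mul_pos_left (hp0.trans_le hp) (by positivity)
  set t : ℝ := (G.card : ℝ) with htdef
  set s : ℝ := (S.card : ℝ) with hsdef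
  have hs0 : 0 ≤ s := Nat.cast_nonneg _
  set Q := ∑ u, dev S u * dev S u with hQ
  have hQ0 : 0 ≤ Q := sum_dev_mul_dev_nonneg S S
  have hQ1 : Q ≤ p * s ^ 2 / t := by
    rw [le_div_iff₀ ht, mul_comm]; exact card_mul_sum_dev_sq_le hG hS
  set E1 : ℝ := s ^ 4 * t⁻¹ with hE1
  set E2 : ℝ := p * s ^ 3 * (z ^ 4)⁻¹ with hE2
  have hE1' : 0 ≤ E1 := by positivity
  have hE2' : 0 ≤ E2 := by positivity
  have hbQ : s ^ 2 / p * Q ≤ E1 := by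
    calc s ^ 2 / p * Q ≤ s ^ 2 / p * (p * s ^ 2 / t) :=
          mul_le_mul_of_nonneg_left hQ1 (by positivity)
      _ = E1 := by rw [hE1]; field_simp
  have hcube : |∑ u, dev S u ^ 3| ≤ (K + 3 + c) * E2 := by
    by_cases hsmall : 16 * G.card ^ 4 ≤ p ^ 3
    · set C₀ : ℝ := 32000 + 256 * κ ^ 3 with hC₀
      have hC₀1 : 1 ≤ C₀ := by
        have : 0 < κ ^ 3 := by positivity
        rw [hC₀]; linarith
      have hN : ∀ ξ ≠ 0, ∀ η ≠ 0, ∀ ζ ≠ 0, (relationCount G ξ η ζ : ℝ) ≤ C₀ * z ^ 5 := by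
        intro ξ hξ η hη ζ hζ
        refine (pow_le_pow_iff_left₀ (by positivity) (by positivity) (three_ne_zero)).1 ?_
        calc (relationCount G ξ η ζ : ℝ) ^ 3 ≤ C₀ * t ^ 5 :=
              relationCount_cube_le hG hp hsmall hξ hη hζ
          _ ≤ C₀ ^ 3 * t ^ 5 :=
              mul_le_mul_of_nonneg_right (le_self_pow₀ hC₀1 (by norm_num)) (by positivity)
          _ = (C₀ * z ^ 5) ^ 3 := by rw [← hz]; ring
      have h1 := abs_sum_dev_cube_le hG hS hN (by positivity)
      rw [← htdef, ← hsdef] at h1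
      have h2 : |∑ u, dev S u ^ 3| ≤ C₀ * E2 := by
        refine le_of_mul_le_mul_left (h1.trans_eq ?_) (pow_pos ht 3)
        rw [hE2, ← hz]; field_simp
      exact h2.trans (mul_le_mul_of_nonneg_right (by linarith) hE2')
    -- Outside Stepanov's range `√p ≤ 2t^(2/3)`, so the Gauss-sum bound on `dev S` together with the
    -- second moment gives the same estimate.
    · have hlarge : (p : ℝ) ^ 3 ≤ 16 * t ^ 4 := by
        rw [htdef]; exact_mod_cast (not_le.1 hsmall).le
      have hsup : ∀ u ≠ 0, |dev S u| ≤ s * √p / t := by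
        intro u hu
        rw [le_div_iff₀ ht, mul_comm]
        exact card_mul_abs_dev_le hG hS
          (fun ξ hξ => Real.le_sqrt_of_sq_le (norm_dft_sq_le hG hξ)) (Real.sqrt_nonneg _) hu
      have h1 := abs_sum_dev_cube_le_of_sup (S := S) (by positivity) hsup
      have hsqrt : √(p : ℝ) ≤ 2 * z ^ 2 := by
        rw [Real.sqrt_le_left (by positivity)]
        refine (pow_le_pow_iff_left₀ (by positivity) (by positivity) (three_ne_zero)).1 ?_
        calc (p : ℝ) ^ 3 ≤ 16 * t ^ 4 := hlarge
          _ ≤ 64 * t ^ 4 := by gcongr; norm_num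
          _ = ((2 * z ^ 2) ^ 2) ^ 3 := by rw [← hz]; ring
      have hz4 : z ^ 4 ≤ (1 + c) * p := by
        refine (pow_le_pow_iff_left₀ (by positivity) (by positivity) (three_ne_zero)).1 ?_
        calc (z ^ 4) ^ 3 = t ^ 4 := by rw [← hz]; ring
          _ ≤ c * (p : ℝ) ^ 3 := hc
          _ ≤ (1 + c) ^ 3 * (p : ℝ) ^ 3 := by
              refine mul_le_mul_of_nonneg_right ?_ (by positivity)
              nlinarith [pow_nonneg hc0 2, pow_nonneg hc0 3]
          _ = _ := by ring
      have h2 : s ^ 3 ≤ (1 + c) * E2 := by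
        calc s ^ 3 = z ^ 4 * (s ^ 3 * (z ^ 4)⁻¹) := by field_simp
          _ ≤ (1 + c) * p * (s ^ 3 * (z ^ 4)⁻¹) :=
              mul_le_mul_of_nonneg_right hz4 (by positivity)
          _ = (1 + c) * E2 := by rw [hE2]; ring
      have h3 : s * √p / t * Q ≤ 2 * E2 := by
        calc s * √p / t * Q ≤ s * (2 * z ^ 2) / t * (p * s ^ 2 / t) := by gcongr
          _ = 2 * E2 := by rw [hE2, ← hz]; field_simp
      have hKE : 0 ≤ K * E2 := by positivity
      linarith
  have h5 := sum_diffCount_mul_sq_sub S S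
  have h6 : ∑ u, dev S u * dev S u ^ 2 = ∑ u, dev S u ^ 3 :=
    Finset.sum_congr rfl fun u _ => by ring
  rw [h6, ← hsdef, ← hQ] at h5
  rw [h5]
  have hrem : 0 ≤ 2 * (s ^ 2 / p) * Q + s ^ 2 / p * Q := by positivity
  have hcK : c ≤ K * c := le_mul_of_one_le_left hc0 (by linarith)
  calc |∑ u, dev S u ^ 3 + 2 * (s ^ 2 / p) * Q + s ^ 2 / p * Q|
      ≤ |∑ u, dev S u ^ 3| + (2 * (s ^ 2 / p) * Q + s ^ 2 / p * Q) := by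
        rw [add_assoc]
        exact (abs_add_le _ _).trans_eq (by rw [abs_of_nonneg hrem])
    _ ≤ 3 * E1 + (K + 3 + c) * E2 := by linarith
    _ ≤ 20 * K * (1 + c) * E1 + 20 * K * (1 + c) * E2 := by gcongr <;> linarith
    _ = _ := by ring

end Bounds

/-! ### From subgroups of units to finite sets of residues. -/

section Translation

variable {p : ℕ} [Fact p.Prime]

open Classical in
/-- A subgroup of `𝔽_p^*` as a finite subset of `𝔽_p`. -/
noncomputable def toFinset (Γ : Subgroup (ZMod p)ˣ) : Finset (ZMod p) :=
  {x | x ∈ toSet Γ}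

theorem mem_toFinset {Γ : Subgroup (ZMod p)ˣ} {x : ZMod p} : x ∈ toFinset Γ ↔ x ∈ toSet Γ := by
  simp [toFinset]

theorem coe_toFinset (Γ : Subgroup (ZMod p)ˣ) : (toFinset Γ : Set (ZMod p)) = toSet Γ := by
  ext x; exact mem_toFinset

theorem card_toFinset (Γ : Subgroup (ZMod p)ˣ) : (toFinset Γ).card = Nat.card Γ := by
  rw [← Set.ncard_coe_finset, coe_toFinset, toSet,
    Set.ncard_image_of_injective _ Units.val_injective]
  rfl

/-- The equation `x^t = 1` has at most `t` roots in a field, and the `t` elements of `Γ` are roots.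
The finite-set arguments access the subgroup structure through this description. -/
theorem mem_toFinset_iff_pow (Γ : Subgroup (ZMod p)ˣ) (x : ZMod p) :
    x ∈ toFinset Γ ↔ x ^ (toFinset Γ).card = 1 := by
  classical
  have hpos : 0 < (toFinset Γ).card := by rw [card_toFinset]; exact Nat.card_pos
  have hsub : toFinset Γ ⊆ (Polynomial.nthRoots (toFinset Γ).card (1 : ZMod p)).toFinset := by
    intro y hy
    rw [Multiset.mem_toFinset, Polynomial.mem_nthRoots hpos]
    obtain ⟨u, hu, rfl⟩ := mem_toFinset.1 hy
    have : u ^ Nat.card Γ = 1 := by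
      have := pow_card_eq_one' (x := (⟨u, hu⟩ : Γ))
      exact congrArg Subtype.val this
    rw [card_toFinset]
    show ((u : (ZMod p)ˣ) : ZMod p) ^ Nat.card Γ = 1
    rw [← Units.val_pow_eq_pow_val, this, Units.val_one]
  have heq := Finset.eq_of_subset_of_card_le hsub
    ((Multiset.toFinset_card_le _).trans (Polynomial.card_nthRoots _ _))
  constructor
  · intro h
    have := hsub h
    rwa [Multiset.mem_toFinset, Polynomial.mem_nthRoots hpos] at this
  · intro h
    rw [heq, Multiset.mem_toFinset, Polynomial.mem_nthRoots hpos]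
    exact h

theorem bddAbove_norm_dft (A : Finset (ZMod p)) :
    BddAbove (Set.range fun ξ : {ξ : ZMod p // ξ ≠ 0} => ‖dft A ξ.1‖) :=
  (Set.finite_range _).bddAbove

theorem maxFourier_eq (Γ : Subgroup (ZMod p)ˣ) :
    maxFourier Γ = ⨆ ξ : {ξ : ZMod p // ξ ≠ 0}, ‖dft (toFinset Γ) ξ.1‖ := rfl

theorem norm_dft_le_maxFourier (Γ : Subgroup (ZMod p)ˣ) :
    ∀ ξ ≠ 0, ‖dft (toFinset Γ) ξ‖ ≤ maxFourier Γ := by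
  intro ξ hξ
  rw [maxFourier_eq]
  exact le_ciSup (bddAbove_norm_dft (toFinset Γ)) ⟨ξ, hξ⟩

theorem maxFourier_nonneg (Γ : Subgroup (ZMod p)ˣ) : 0 ≤ maxFourier Γ := by
  rw [maxFourier_eq]; exact Real.iSup_nonneg fun _ => norm_nonneg _

theorem maxFourier_sq_le (Γ : Subgroup (ZMod p)ˣ) : maxFourier Γ ^ 2 ≤ p := by
  have h : maxFourier Γ ≤ √p := by
    rw [maxFourier_eq]
    exact Real.iSup_le (fun ξ => Real.le_sqrt_of_sq_le
      (norm_dft_sq_le (mem_toFinset_iff_pow Γ) ξ.2)) (Real.sqrt_nonneg _)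
  calc maxFourier Γ ^ 2 ≤ √(p : ℝ) ^ 2 := pow_le_pow_left₀ (maxFourier_nonneg Γ) h 2
    _ = p := Real.sq_sqrt (Nat.cast_nonneg _)

theorem energy_three_eq (A : Finset (ZMod p)) :
    energy 3 (A : Set (ZMod p)) = ∑ x, (diffCount A x : ℝ) * (diffCount A x : ℝ) ^ 2 := by
  simp only [energy, corr_char_eq_diffCount]
  exact Finset.sum_congr rfl fun x _ => by ring

theorem energyPair_three_eq (A B : Finset (ZMod p)) :
    energyPair 3 (A : Set (ZMod p)) (B : Set (ZMod p))
      = ∑ x, (diffCount A x : ℝ) * (diffCount B x : ℝ) ^ 2 := by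
  simp only [energyPair, corr_char_eq_diffCount]

end Translation

end SubgroupEnergy

/-! ### The main theorem: choice of constants and conversion of exponents. -/

theorem proposition6p1 (c₁ c₂ : ℝ) (hc₁ : 0 < c₁) (hc₂ : 0 < c₂) :
    ∃ C : ℝ, 0 < C ∧ ∀ (p : ℕ) [Fact p.Prime] (Γ : Subgroup (ZMod p)ˣ),
      2 ≤ Nat.card Γ →
      c₁ * (p : ℝ) ^ (1 / 2 : ℝ) ≤ (Nat.card Γ : ℝ) →
      (Nat.card Γ : ℝ) ≤ c₂ * (p : ℝ) ^ (3 / 4 : ℝ) →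
      |SubgroupEnergy.energy 3 (SubgroupEnergy.toSet Γ) - (Nat.card Γ : ℝ) ^ 6 / (p : ℝ) ^ 2| ≤
          C * ((Nat.card Γ : ℝ) ^ 3 * Real.logb 2 (Nat.card Γ : ℝ) ^ 3
            + (p : ℝ) ^ (1 / 3 : ℝ) * SubgroupEnergy.maxFourier Γ ^ (4 / 3 : ℝ)
                * (Nat.card Γ : ℝ) ^ (5 / 3 : ℝ) * Real.logb 2 (Nat.card Γ : ℝ) ^ 3) ∧
      ∀ S : Set (ZMod p), SubgroupEnergy.IsInvariant Γ S →
        |SubgroupEnergy.energyPair 3 (SubgroupEnergy.toSet Γ) S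
            - (Nat.card Γ : ℝ) ^ 2 * (S.ncard : ℝ) ^ 4 / (p : ℝ) ^ 2| ≤
          C * ((S.ncard : ℝ) ^ 2 * (Nat.card Γ : ℝ) * Real.logb 2 (Nat.card Γ : ℝ) ^ 3
            + (S.ncard : ℝ) ^ 3 * SubgroupEnergy.maxFourier Γ ^ 2 / (p : ℝ)
            + (p : ℝ) ^ (2 / 3 : ℝ) * SubgroupEnergy.maxFourier Γ ^ (2 / 3 : ℝ)
                * (S.ncard : ℝ) ^ 2 * (Nat.card Γ : ℝ) ^ (-(1 / 3) : ℝ)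
                * Real.logb 2 (Nat.card Γ : ℝ) ^ 3) ∧
        |SubgroupEnergy.energy 3 S - (S.ncard : ℝ) ^ 6 / (p : ℝ) ^ 2| ≤
          C * ((S.ncard : ℝ) ^ 4 * (Nat.card Γ : ℝ)⁻¹
            + (p : ℝ) * (S.ncard : ℝ) ^ 3 * (Nat.card Γ : ℝ) ^ (-(4 / 3) : ℝ)
                * Real.logb 2 (Nat.card Γ : ℝ) ^ 3) := by
  classical
  -- The size assumptions enter as `p ≤ κ|Γ|²` and `|Γ|⁴ ≤ cp³` with `c = c₂⁴`; `K` is a sum so that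
  -- it passes all its lower thresholds at once.
  set κ : ℝ := (c₁ ^ 2)⁻¹ with hκ
  have hκ0 : 0 < κ := by positivity
  set c : ℝ := c₂ ^ 4 with hc
  have hc0 : 0 ≤ c := by positivity
  set K : ℝ := 32 * (32000 + 256 * κ ^ 3) + κ + 6 with hKdef
  have hκ3 : 0 < κ ^ 3 := by positivity
  have hK6 : 6 ≤ K := by rw [hKdef]; linarith
  have hKκ : κ ≤ K := by rw [hKdef]; linarith
  have hK : 32 * (32000 + 256 * κ ^ 3) < K := by rw [hKdef]; linarith
  have hK0 : 0 < K := by linarith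
  refine ⟨20 * K * (1 + c), by positivity, ?_⟩
  intro p _ Γ ht2 hlow hhigh
  have hp0 := SubgroupEnergy.natCast_pos_of_prime (p := p)
  have hG := SubgroupEnergy.mem_toFinset_iff_pow Γ
  have hcard := SubgroupEnergy.card_toFinset Γ
  have hM := SubgroupEnergy.norm_dft_le_maxFourier Γ
  have hM0 := SubgroupEnergy.maxFourier_nonneg Γ
  have hM2 := SubgroupEnergy.maxFourier_sq_le Γ
  rw [← SubgroupEnergy.coe_toFinset]
  rw [← hcard] at ht2 hlow hhigh ⊢
  set G := SubgroupEnergy.toFinset Γ with hGdef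
  set M := SubgroupEnergy.maxFourier Γ with hMdef
  have ht : (0 : ℝ) < G.card := Nat.cast_pos.2 (by omega)
  have hκp : (p : ℝ) ≤ κ * (G.card : ℝ) ^ 2 := by
    have h1 := pow_le_pow_left₀ (by positivity) hlow 2
    rw [mul_pow, ← Real.rpow_natCast, ← Real.rpow_natCast ((p : ℝ) ^ (1 / 2 : ℝ)),
      ← Real.rpow_mul hp0.le] at h1
    norm_num at h1
    rw [hκ, inv_mul_eq_div, le_div_iff₀ (by positivity)]
    linarith
  have hcp : (G.card : ℝ) ^ 4 ≤ c * (p : ℝ) ^ 3 := by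
    have h1 := pow_le_pow_left₀ ht.le hhigh 4
    rw [mul_pow, ← Real.rpow_natCast ((p : ℝ) ^ (3 / 4 : ℝ)), ← Real.rpow_mul hp0.le] at h1
    have h2 : (3 / 4 : ℝ) * ((4 : ℕ) : ℝ) = ((3 : ℕ) : ℝ) := by norm_num
    rwa [h2, Real.rpow_natCast] at h1
  set L : ℝ := Real.logb 2 (G.card : ℝ) with hL
  have hL1 : 1 ≤ L := by
    rw [hL, Real.le_logb_iff_rpow_le (by norm_num) ht, Real.rpow_one]
    exact_mod_cast ht2
  -- Both bounds involving `S` are obtained without logarithms; their factors `L³` are inserted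
  -- using `|Γ| ≥ 2`.
  have hL3 : 1 ≤ L ^ 3 := one_le_pow₀ hL1
  -- cube roots
  have hroot : ∀ v : ℝ, 0 ≤ v → (v ^ (1 / 3 : ℝ)) ^ 3 = v := fun v hv => by
    rw [← Real.rpow_natCast, ← Real.rpow_mul hv]; norm_num
  have hpow : ∀ v : ℝ, 0 ≤ v → ∀ n : ℕ, v ^ (n / 3 : ℝ) = (v ^ (1 / 3 : ℝ)) ^ n := fun v hv n => by
    rw [← Real.rpow_natCast, ← Real.rpow_mul hv]; congr 1; ring
  have hx := hroot p hp0.le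
  have hy := hroot M hM0
  have hz := hroot G.card ht.le
  have hx2 := hpow p hp0.le 2
  have hy2 := hpow M hM0 2
  have hy4 := hpow M hM0 4
  have hz4 := hpow G.card ht.le 4
  have hz5 := hpow G.card ht.le 5
  push_cast at hx2 hy2 hy4 hz4 hz5
  rw [Real.rpow_neg ht.le, Real.rpow_neg ht.le, hx2, hy2, hy4, hz4, hz5]
  have hx0 : 0 < (p : ℝ) ^ (1 / 3 : ℝ) := Real.rpow_pos_of_pos hp0 _
  have hy0 : 0 ≤ M ^ (1 / 3 : ℝ) := Real.rpow_nonneg hM0 _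
  have hz0 : 0 < (G.card : ℝ) ^ (1 / 3 : ℝ) := Real.rpow_pos_of_pos ht _
  refine ⟨?_, ?_⟩
  · have h1 := SubgroupEnergy.energy_subgroup_bound hG hM hM2 hκp hc0 hcp hK6 hKκ hK ht2
      hx hy hz hx0 hz0
    rwa [← pow_add, ← SubgroupEnergy.energy_three_eq] at h1
  · rintro S ⟨hS0, hSinv⟩
    obtain ⟨T, rfl⟩ : ∃ T : Finset (ZMod p), (T : Set (ZMod p)) = S :=
      ⟨S.toFinite.toFinset, S.toFinite.coe_toFinset⟩
    have hT0 : (0 : ZMod p) ∉ T := by simpa using hS0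
    have hT : ∀ γ ∈ G, ∀ x ∈ T, γ * x ∈ T := by
      intro γ hγ x hx
      rw [mul_comm γ x, ← Finset.mem_coe, ← hSinv]
      exact Set.mul_mem_mul hx (SubgroupEnergy.mem_toFinset.1 hγ)
    rw [Set.ncard_coe_finset, SubgroupEnergy.energyPair_three_eq, SubgroupEnergy.energy_three_eq]
    set s : ℝ := (T.card : ℝ) with hs
    have hs0 : 0 ≤ s := Nat.cast_nonneg _
    constructor
    · refine (SubgroupEnergy.energyPair_bound hG hT hT0 hM hκp hK6 hK hx hy hz hx0 hy0 hz0).trans ?_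
      refine mul_le_mul (le_mul_of_one_le_right (by positivity) (by linarith)) ?_
        (by positivity) (by positivity)
      refine add_le_add (add_le_add_left ?_ _) ?_
      · exact le_mul_of_one_le_right (by positivity) hL3
      · exact le_mul_of_one_le_right (by positivity) hL3
    · have h1 := SubgroupEnergy.energy_invariant_bound hG hT hκp hc0 hcp hK6 hK hz hz0
      rw [← pow_add] at h1
      refine h1.trans (mul_le_mul_of_nonneg_left ?_ (by positivity))
      exact add_le_add_right (le_mul_of_one_le_right (by positivity) hL3) _
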